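/- Let $\mathrm{NE}=\mathrm{NTIME}[2^{O(n)}]$ (languages over $\{0,1\}$), and let $\mathrm{FP}^{\mathrm{NE}}$ be the class of functions $\{0,1\}^*\to\{0,1\}^*$ computable by a deterministic polynomial-time oracle Turing machine with an oracle from $\mathrm{NE}$. For $k\ge 0$, an $\mathrm{ACC}^k$ circuit family is a sequence $(C_n)_{n\ge 0}$, where $C_n$ is a circuit with $n$ input bits built from unbounded fan-in AND, OR and $\mathrm{MOD}_m$ gates and NOT gates, for a constant $m\ge 2$ that is the same for the whole family (a $\mathrm{MOD}_m$ gate outputs $1$ iff the number of its inputs equal to $1$ is divisible by $m$), such that the size of $C_n$ is bounded by a polynomial in $n$ and its depth is $O(\log^k n)$. A language $A$ has (nonuniform) $\mathrm{ACC}^k$ circuits if there is an $\mathrm{ACC}^k$ family $(C_n)$ such that for all $x$, $x\in A$ iff $C_{|x|}(x)=1$. It has $\mathrm{P}^{\mathrm{NE}}$-uniform $\mathrm{ACC}^k$ circuits if there are such a family and a function $f\in\mathrm{FP}^{\mathrm{NE}}$ such that for every $j\ge 0$, $f(1^j)$ is the description of $C_j$ under a fixed standard binary encoding of circuits. Theorem.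 For every $k\in\{0,1,2,\ldots\}$: every language in $\mathrm{NE}$ has (nonuniform) $\mathrm{ACC}^k$ circuits if and only if every language in $\mathrm{NE}$ has $\mathrm{P}^{\mathrm{NE}}$-uniform $\mathrm{ACC}^k$ circuits. -/

import Mathlib

namespace ACCUniform

/-! ### Machines

Multi-stack Turing machines over the alphabet `Bool`: a finite control acting on finitely many
stacks (a two-way infinite tape is a pair of stacks, and a larger alphabet is coded in blocks of
bits, so these machines and multi-tape Turing machines simulate each other with polynomial
overhead).  A stack is a `List Bool` whose head is the top of the stack. -/

/-- One instruction of a machine with state set `Q` and stack set `K`. Each costs one step. -/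
inductive Instr (Q K : Type) where
  /-- push the bit `b` on stack `k` and go to state `q` -/
  | push (k : K) (b : Bool) (q : Q)
  /-- pop stack `k`; go to `q₀` or `q₁` according to the removed bit, to `qe` if `k` was empty -/
  | pop (k : K) (qe q₀ q₁ : Q)
  /-- nondeterministic choice: go to `q₀` or to `q₁` -/
  | guess (q₀ q₁ : Q)
  /-- ask the oracle whether the string on stack `k` belongs to it -/
  | query (k : K) (qyes qno : Q)
  /-- halt, accepting or rejecting -/
  | halt (accept : Bool)

/-- A (possibly nondeterministic, possibly oracle) machine. -/
structure Machine where
  /-- the states of the finite control -/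
  State : Type
  /-- the names of the stacks -/
  Stack : Type
  [finState : Fintype State]
  [finStack : Fintype Stack]
  [decStack : DecidableEq Stack]
  /-- the initial state -/
  start : State
  /-- the stack that holds the input -/
  inp : Stack
  /-- the stack that holds the output -/
  out : Stack
  /-- the program -/
  prog : State → Instr State Stack

namespace Machine

attribute [instance] finState finStack decStack

/-- A configuration: the current state and the contents of all stacks. -/
structure Cfg (M : Machine) where
  state : M.State
  stk : M.Stack → List Bool

/-- The initial configuration on input `x`: all stacks but the input stack are empty. -/
def init (M : Machine) (x : List Bool) : M.Cfg :=
  ⟨M.start, fun k => if k = M.inp then x else []⟩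

open Classical in
/-- One step with oracle `O`, where `b` is the bit used if the instruction is a nondeterministic
choice. A halted configuration does not change any more. -/
noncomputable def step (M : Machine) (O : Language Bool) (c : M.Cfg) (b : Bool) : M.Cfg :=
  match M.prog c.state with
  | .push k a q => ⟨q, Function.update c.stk k (a :: c.stk k)⟩
  | .pop k qe q₀ q₁ =>
    match c.stk k with
    | [] => ⟨qe, c.stk⟩
    | false :: s => ⟨q₀, Function.update c.stk k s⟩
    | true :: s => ⟨q₁, Function.update c.stk k s⟩
  | .guess q₀ q₁ => ⟨if b then q₁ else q₀, c.stk⟩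
  | .query k qyes qno => ⟨if c.stk k ∈ O then qyes else qno, c.stk⟩
  | .halt _ => c

/-- `g.length` steps along the computation path given by the choice sequence `g`. -/
noncomputable def run (M : Machine) (O : Language Bool) (g : List Bool) (c : M.Cfg) : M.Cfg :=
  g.foldl (M.step O) c

/-- The configuration is a halted one. -/
def Cfg.Halted {M : Machine} (c : M.Cfg) : Prop :=
  ∃ a, M.prog c.state = .halt a

/-- The configuration is a halted one that accepts. -/
def Cfg.Accepting {M : Machine} (c : M.Cfg) : Prop :=
  M.prog c.state = .halt true

/-- On input `x` with oracle `O`, every computation path halts within `t` steps. -/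
def HaltsWithin (M : Machine) (O : Language Bool) (x : List Bool) (t : ℕ) : Prop :=
  ∀ g : List Bool, g.length = t → (M.run O g (M.init x)).Halted

/-- On input `x` with oracle `O`, some computation path accepts. -/
def Accepts (M : Machine) (O : Language Bool) (x : List Bool) : Prop :=
  ∃ g : List Bool, (M.run O g (M.init x)).Accepting

/-- The program contains no nondeterministic choice. -/
def Deterministic (M : Machine) : Prop :=
  ∀ q q₀ q₁, M.prog q ≠ .guess q₀ q₁

/-- The program contains no oracle query. -/
def QueryFree (M : Machine) : Prop :=
  ∀ q k qyes qno, M.prog q ≠ .query k qyes qno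

end Machine

/-- `NE = NTIME[2^{O(n)}]`. A query-free machine does not depend on the oracle, which is
taken to be empty. -/
def NE : Set (Language Bool) :=
  {L | ∃ M : Machine, M.QueryFree ∧ ∃ c : ℕ, ∀ x : List Bool,
    M.HaltsWithin ⊥ x (c * 2 ^ (c * x.length)) ∧ (x ∈ L ↔ M.Accepts ⊥ x)}

/-- `FP^O`: the functions computed by a deterministic polynomial-time machine with oracle `O`. -/
def FPWith (O : Language Bool) : Set (List Bool → List Bool) :=
  {f | ∃ M : Machine, M.Deterministic ∧ ∃ p : Polynomial ℕ, ∀ x : List Bool,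
    ∀ g : List Bool, g.length = p.eval x.length →
      (M.run O g (M.init x)).Halted ∧ (M.run O g (M.init x)).stk M.out = f x}

/-- `FP^NE`. -/
def FPNE : Set (List Bool → List Bool) :=
  {f | ∃ O ∈ NE, f ∈ FPWith O}

/-! ### Circuits

Circuits with gates AND, OR (both of unbounded fan-in), NOT and MOD_m (of unbounded fan-in), as a
list of gates in topological order: a gate refers to earlier gates through their position in the
list. The AND and the OR of no arguments are the constants true and false. -/

/-- A gate, with the positions of the gates that feed it. -/
inductive Gate where
  /-- the `i`-th input bit -/
  | input (i : ℕ)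
  | not (j : ℕ)
  | and (js : List ℕ)
  | or (js : List ℕ)
  /-- the MOD_m gate: true if and only if the number of true arguments is divisible by `m` -/
  | mod (js : List ℕ)

namespace Gate

/-- The positions of the gates that feed a gate. -/
def args : Gate → List ℕ
  | input _ => []
  | not j => [j]
  | and js => js
  | or js => js
  | mod js => js

/-- The gate may stand at position `pos` of a circuit with `n` inputs. -/
def WellFormed (n pos : ℕ) : Gate → Prop
  | input i => i < n
  | g => ∀ j ∈ g.args, j < pos

/-- The value of a gate on the input `x`, from the list `v` of the values of the earlier gates. -/
def eval (m : ℕ) (x v : List Bool) : Gate → Bool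
  | input i => x.getD i false
  | not j => !v.getD j false
  | and js => js.all fun j => v.getD j false
  | or js => js.any fun j => v.getD j false
  | mod js => decide (m ∣ js.countP fun j => v.getD j false)

/-- The depth of a gate, from the list `d` of the depths of the earlier gates. -/
def depth (d : List ℕ) : Gate → ℕ
  | input _ => 0
  | g => (g.args.map fun j => d.getD j 0).foldr max 0 + 1

end Gate

/-- A circuit with `n` inputs; the last gate is the output. -/
structure Circuit (n : ℕ) where
  gates : List Gate
  nonempty : gates ≠ []
  wellFormed : ∀ (i : ℕ) (h : i < gates.length), gates[i].WellFormed n i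

namespace Circuit

variable {n : ℕ}

/-- The values of all gates on the input `x`, where the MOD gates have modulus `m`. -/
def values (C : Circuit n) (m : ℕ) (x : List Bool) : List Bool :=
  C.gates.foldl (fun v g => v ++ [g.eval m x v]) []

/-- The output of the circuit on the input `x`. -/
def eval (C : Circuit n) (m : ℕ) (x : List Bool) : Bool :=
  (C.values m x).getLastD false

/-- The depth: the maximal number of non-input gates on a path. -/
def depth (C : Circuit n) : ℕ :=
  (C.gates.foldl (fun d g => d ++ [g.depth d]) []).foldr max 0

/-- The size: the number of gates plus the number of wires. -/
def size (C : Circuit n) : ℕ :=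
  (C.gates.map fun g => 1 + g.args.length).sum

end Circuit

/-! ### Descriptions of circuits

The description lists the gates in order. Positions are written in unary, so that the length of
the description is polynomial in the size of the circuit and the number of inputs. -/

/-- The self-delimiting unary code of a natural number. -/
def encodeNat (i : ℕ) : List Bool :=
  List.replicate i true ++ [false]

/-- The self-delimiting code of a list of natural numbers. -/
def encodeArgs (js : List ℕ) : List Bool :=
  (js.flatMap fun j => true :: encodeNat j) ++ [false]

/-- The description of a gate: a tag for its type, then its arguments. -/
def Gate.encode : Gate → List Bool
  | .input i => false :: false :: encodeNat i
  | .not j => false :: true :: encodeNat j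
  | .and js => true :: false :: false :: encodeArgs js
  | .or js => true :: false :: true :: encodeArgs js
  | .mod js => true :: true :: encodeArgs js

/-- The description of a circuit. -/
def Circuit.encode {n : ℕ} (C : Circuit n) : List Bool :=
  C.gates.flatMap Gate.encode

/-! ### ACC^k -/

/-- The size of the family `C` (one circuit per input length) is polynomial and its depth is
`O(log^k n)`. (The `+ 1` only matters for `n ≤ 1`, where the logarithm vanishes.) -/
def IsACCBounded (k : ℕ) (C : (n : ℕ) → Circuit n) : Prop :=
  (∃ p : Polynomial ℕ, ∀ n, (C n).size ≤ p.eval n) ∧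
  ∃ c : ℕ, ∀ n, (C n).depth ≤ c * (Nat.log 2 n + 1) ^ k

/-- The family `C`, with MOD gates of modulus `m`, decides the language `A`. -/
def Decides (m : ℕ) (C : (n : ℕ) → Circuit n) (A : Language Bool) : Prop :=
  ∀ x : List Bool, x ∈ A ↔ (C x.length).eval m x = true

/-- `A` has (nonuniform) `ACC^k` circuits: polynomial size, depth `O(log^k n)`, gates AND, OR, NOT
and MOD_m for one constant `m`. -/
def HasACC (k : ℕ) (A : Language Bool) : Prop :=
  ∃ m : ℕ, 2 ≤ m ∧ ∃ C : (n : ℕ) → Circuit n, IsACCBounded k C ∧ Decides m C A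

/-- `A` has `P^NE`-uniform `ACC^k` circuits: some `ACC^k` family for `A` has a generator in `FP^NE`
that on input `1^j` outputs the description of the circuit for inputs of length `j`. -/
def HasUniformACC (k : ℕ) (A : Language Bool) : Prop :=
  ∃ m : ℕ, 2 ≤ m ∧ ∃ C : (n : ℕ) → Circuit n, IsACCBounded k C ∧ Decides m C A ∧
    ∃ f ∈ FPNE, ∀ j : ℕ, f (List.replicate j true) = (C j).encode

end ACCUniform

/-!
Fix an `NE` machine for `A` and an input length `n`. That a circuit is sound, i.e. accepts only
strings of `A`, has certificates of size `2 ^ O(n)`: an accepting computation for each accepted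
string. Correctness cannot be certified in this way, but if there is a correct circuit of the
allowed size, then the correct circuits are the sound ones that accept the most strings. So order
the sound circuits by the number of accepted strings, then by decreasing depth; a greatest one is
correct and no deeper than the given circuit, for every constant in the depth bound at once. Write
this order as the lexicographic order of strings, by the profile of a circuit: the number of
accepted strings in binary, the depth in unary and the description. The greatest profile is found
bit by bit, asking an `NE` oracle whether a prefix can be extended to the profile of a sound
circuit; the oracle evaluates the guessed circuit on all `2 ^ n` inputs, so that the count in the
profile is exact.

The bounds on running times come from a calculus of functions on binary trees whose combinators
preserve polynomial time. Its terms are translated to stack programs, and these to machines.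
-/

namespace ACCUniform

/-! ### Stack programs -/

/-- Structured programs on registers `0, 1, 2, …`, each holding a stack of bits. They are the source
language of the compiler `Cmd.toMachine`. -/
inductive Cmd where
  | skip
  | push (r : ℕ) (b : Bool)
  /-- run `ce` if `r` is empty, otherwise pop a bit `b` from `r` and run `c b` -/
  | pop (r : ℕ) (ce : Cmd) (c : Bool → Cmd)
  /-- run `c b` for a nondeterministically chosen bit `b` -/
  | guess (c : Bool → Cmd)
  /-- run `c b`, where `b` is the answer of the oracle to the contents of `r` -/
  | query (r : ℕ) (c : Bool → Cmd)
  | seq (a b : Cmd)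
  /-- pop bits `b` from `r` until it is empty, running `c b` after each of them -/
  | loop (r : ℕ) (c : Bool → Cmd)

namespace Cmd

/-- The contents of the registers. -/
abbrev Store := ℕ → List Bool

/-- `Exec O c s g s'`: with oracle `O`, the program `c` leads from `s` to `s'` in `g.length` steps
along the path given by the choice sequence `g`. -/
inductive Exec (O : Language Bool) : Cmd → Store → List Bool → Store → Prop
  | skip (s) : Exec O skip s [] s
  | push (r b s x) : Exec O (push r b) s [x] (Function.update s r (b :: s r))
  | popNil {r ce c s g s'} (x) (h : s r = []) (he : Exec O ce s g s') :
      Exec O (pop r ce c) s (x :: g) s'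
  | popCons {r ce c s g s' b l} (x) (h : s r = b :: l)
      (he : Exec O (c b) (Function.update s r l) g s') : Exec O (pop r ce c) s (x :: g) s'
  | guess {c s g s'} (b) (he : Exec O (c b) s g s') : Exec O (guess c) s (b :: g) s'
  | query {r c s g s' b} (x) (h : b = true ↔ s r ∈ O) (he : Exec O (c b) s g s') :
      Exec O (query r c) s (x :: g) s'
  | seq {a b s g₁ s₁ g₂ s₂} (ha : Exec O a s g₁ s₁) (hb : Exec O b s₁ g₂ s₂) :
      Exec O (seq a b) s (g₁ ++ g₂) s₂
  | loopNil {r c s} (x) (h : s r = []) : Exec O (loop r c) s [x] s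
  | loopCons {r c s g s' b l} (x) (h : s r = b :: l)
      (he : Exec O (seq (c b) (loop r c)) (Function.update s r l) g s') :
      Exec O (loop r c) s (x :: g) s'

/-! ### Compilation to machines -/

/-- The control points of a program, which are states of the compiled machine. -/
def Pos : Cmd → Type
  | skip => Empty
  | push _ _ => Unit
  | pop _ ce c => Unit ⊕ Pos ce ⊕ (b : Bool) × Pos (c b)
  | guess c => Unit ⊕ (b : Bool) × Pos (c b)
  | query _ c => Unit ⊕ (b : Bool) × Pos (c b)
  | seq a b => Pos a ⊕ Pos b
  | loop _ c => Unit ⊕ (b : Bool) × Pos (c b)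

instance finite_pos (c : Cmd) : Finite (Pos c) := by
  induction c <;> simp only [Pos] <;> infer_instance

/-- The state in which a program starts, if its control points are embedded by `ι` and it is left
through `e`. -/
def entry {R : Type} : (c : Cmd) → (Pos c → R) → R → R
  | skip, _, e => e
  | push _ _, ι, _ => ι ()
  | pop _ _ _, ι, _ => ι (.inl ())
  | guess _, ι, _ => ι (.inl ())
  | query _ _, ι, _ => ι (.inl ())
  | seq a b, ι, e => entry a (fun p => ι (.inl p)) (entry b (fun p => ι (.inr p)) e)
  | loop _ _, ι, _ => ι (.inl ())

/-- The instructions at the control points of a program, if these are embedded by `ι` and the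
program is left through `e`. Registers are taken modulo `N + 1`. -/
def code {R : Type} (N : ℕ) : (c : Cmd) → (Pos c → R) → R → Pos c → Instr R (Fin (N + 1))
  | push r b, _, e, _ => .push (Fin.ofNat _ r) b e
  | pop r ce c, ι, e, p =>
    let branch b := entry (c b) (fun p => ι (.inr (.inr ⟨b, p⟩))) e
    match p with
    | .inl _ =>
      .pop (Fin.ofNat _ r) (entry ce (fun p => ι (.inr (.inl p))) e) (branch false) (branch true)
    | .inr (.inl p) => code N ce (fun p => ι (.inr (.inl p))) e p
    | .inr (.inr ⟨b, p⟩) => code N (c b) (fun p => ι (.inr (.inr ⟨b, p⟩))) e p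
  | guess c, ι, e, p =>
    let branch b := entry (c b) (fun p => ι (.inr ⟨b, p⟩)) e
    match p with
    | .inl _ => .guess (branch false) (branch true)
    | .inr ⟨b, p⟩ => code N (c b) (fun p => ι (.inr ⟨b, p⟩)) e p
  | query r c, ι, e, p =>
    let branch b := entry (c b) (fun p => ι (.inr ⟨b, p⟩)) e
    match p with
    | .inl _ => .query (Fin.ofNat _ r) (branch true) (branch false)
    | .inr ⟨b, p⟩ => code N (c b) (fun p => ι (.inr ⟨b, p⟩)) e p
  | seq a b, ι, e, p =>
    match p with
    | .inl p => code N a (fun p => ι (.inl p)) (entry b (fun p => ι (.inr p)) e) p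
    | .inr p => code N b (fun p => ι (.inr p)) e p
  | loop r c, ι, e, p =>
    let branch b := entry (c b) (fun p => ι (.inr ⟨b, p⟩)) (ι (.inl ()))
    match p with
    | .inl _ => .pop (Fin.ofNat _ r) e (branch false) (branch true)
    | .inr ⟨b, p⟩ => code N (c b) (fun p => ι (.inr ⟨b, p⟩)) (ι (.inl ())) p

/-- An upper bound for the registers that occur in a program. -/
def maxReg : Cmd → ℕ
  | skip => 0
  | push r _ => r
  | pop r ce c => max r (max ce.maxReg (max (c false).maxReg (c true).maxReg))
  | guess c => max (c false).maxReg (c true).maxReg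
  | query r c => max r (max (c false).maxReg (c true).maxReg)
  | seq a b => max a.maxReg b.maxReg
  | loop r c => max r (max (c false).maxReg (c true).maxReg)

/-- The machine that runs `c` with input and output in register `0`, then pops a bit from
register `1` and accepts if it is `true`. -/
noncomputable def toMachine (c : Cmd) : Machine where
  State := Pos c ⊕ Option Bool
  Stack := Fin (max c.maxReg 1 + 1)
  finState := Fintype.ofFinite _
  start := entry c Sum.inl (Sum.inr none)
  inp := Fin.ofNat _ 0
  out := Fin.ofNat _ 0
  prog
    | .inl p => code _ c Sum.inl (Sum.inr none) p
    | .inr none => .pop (Fin.ofNat _ 1) (.inr (some false)) (.inr (some false)) (.inr (some true))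
    | .inr (some b) => .halt b

/-- The configuration of the compiled machine with registers `s`. -/
def cfg (c : Cmd) (q : c.toMachine.State) (s : Store) : c.toMachine.Cfg :=
  ⟨q, fun i : Fin _ => s i⟩

section Compilation

variable {O : Language Bool} {c : Cmd} {s : Store} {r : ℕ} {q qe q₀ q₁ : c.toMachine.State}

theorem val_ofNat_of_le {N : ℕ} (hr : r ≤ N) : (Fin.ofNat (N + 1) r : ℕ) = r :=
  Nat.mod_eq_of_lt (Nat.lt_succ_of_le hr)

theorem update_comp_val {N : ℕ} (hr : r ≤ N) (l : List Bool) :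
    (fun i : Fin (N + 1) => Function.update s r l i) =
      Function.update (fun i : Fin (N + 1) => s i) (Fin.ofNat _ r) l := by
  have h := Function.update_comp_eq_of_injective s (Fin.val_injective (n := N + 1))
    (Fin.ofNat _ r) l
  rwa [val_ofNat_of_le hr] at h

theorem cfg_update (hr : r ≤ max c.maxReg 1) (l : List Bool) :
    c.cfg q (Function.update s r l) = ⟨q, Function.update (c.cfg q s).stk (Fin.ofNat _ r) l⟩ :=
  congrArg (Machine.Cfg.mk q) (update_comp_val hr l)

theorem step_push (hr : r ≤ max c.maxReg 1) {b : Bool}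
    (hq : c.toMachine.prog q = .push (Fin.ofNat _ r) b q₀) (x : Bool) :
    c.toMachine.step O (c.cfg q s) x = c.cfg q₀ (Function.update s r (b :: s r)) := by
  rw [cfg_update hr]
  simp only [Machine.step, cfg, hq, val_ofNat_of_le hr]

theorem step_pop_nil (hr : r ≤ max c.maxReg 1)
    (hq : c.toMachine.prog q = .pop (Fin.ofNat _ r) qe q₀ q₁) (h : s r = []) (x : Bool) :
    c.toMachine.step O (c.cfg q s) x = c.cfg qe s := by
  simp only [Machine.step, cfg, hq, val_ofNat_of_le hr, h]

theorem step_pop_cons (hr : r ≤ max c.maxReg 1)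
    (hq : c.toMachine.prog q = .pop (Fin.ofNat _ r) qe q₀ q₁) {b : Bool} {l : List Bool}
    (h : s r = b :: l) (x : Bool) :
    c.toMachine.step O (c.cfg q s) x = c.cfg (bif b then q₁ else q₀) (Function.update s r l) := by
  rw [cfg_update hr]
  cases b <;> simp only [Machine.step, cfg, hq, val_ofNat_of_le hr, h, cond]

theorem step_query (hr : r ≤ max c.maxReg 1)
    (hq : c.toMachine.prog q = .query (Fin.ofNat _ r) q₁ q₀) {b : Bool}
    (h : b = true ↔ s r ∈ O) (x : Bool) :
    c.toMachine.step O (c.cfg q s) x = c.cfg (bif b then q₁ else q₀) s := by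
  cases b <;> simp only [Machine.step, cfg, hq, val_ofNat_of_le hr, ← h] <;> rfl

theorem step_guess (hq : c.toMachine.prog q = .guess q₀ q₁) (b : Bool) :
    c.toMachine.step O (c.cfg q s) b = c.cfg (bif b then q₁ else q₀) s := by
  cases b <;> simp [Machine.step, cfg, hq]

theorem Exec.run_eq {a : Cmd} {s' : Store} {g : List Bool} (h : Exec O a s g s')
    (ha : a.maxReg ≤ max c.maxReg 1) (ι : Pos a → c.toMachine.State) (e : c.toMachine.State)
    (hι : ∀ p, c.toMachine.prog (ι p) = code _ a ι e p) :
    c.toMachine.run O g (c.cfg (entry a ι e) s) = c.cfg e s' := by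
  induction h generalizing e with
  | skip => rfl
  | push r b s x => exact step_push ha (hι ()) x
  | popNil x h _ ih =>
    simp only [maxReg, max_le_iff] at ha
    rw [← ih ha.2.1 (fun p => ι (.inr (.inl p))) e fun _ => hι _]
    exact congrArg (Machine.run _ _ _) (step_pop_nil ha.1 (hι (.inl ())) h x)
  | @popCons _ _ a _ _ _ b _ x h _ ih =>
    simp only [maxReg, max_le_iff] at ha
    rw [← ih (by cases b <;> simp [ha]) (fun p => ι (.inr (.inr ⟨b, p⟩))) e fun _ => hι _]
    refine congrArg (Machine.run _ _ _) ((step_pop_cons ha.1 (hι (.inl ())) h x).trans ?_)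
    cases b <;> rfl
  | @guess a _ _ _ b _ ih =>
    simp only [maxReg, max_le_iff] at ha
    rw [← ih (by cases b <;> simp [ha]) (fun p => ι (.inr ⟨b, p⟩)) e fun _ => hι _]
    refine congrArg (Machine.run _ _ _) ((step_guess (hι (.inl ())) b).trans ?_)
    cases b <;> rfl
  | @query _ a _ _ _ b x h _ ih =>
    simp only [maxReg, max_le_iff] at ha
    rw [← ih (by cases b <;> simp [ha]) (fun p => ι (.inr ⟨b, p⟩)) e fun _ => hι _]
    refine congrArg (Machine.run _ _ _) ((step_query ha.1 (hι (.inl ())) h x).trans ?_)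
    cases b <;> rfl
  | seq _ _ iha ihb =>
    simp only [maxReg, max_le_iff] at ha
    rw [← ihb ha.2 (fun p => ι (.inr p)) e fun _ => hι _,
      ← iha ha.1 (fun p => ι (.inl p)) _ fun _ => hι _]
    exact List.foldl_append
  | loopNil x h => exact step_pop_nil (le_of_max_le_left ha) (hι (.inl ())) h x
  | @loopCons r a _ _ _ b _ x h _ ih =>
    have hr := le_of_max_le_left ha
    let ι' : Pos ((a b).seq (.loop r a)) → c.toMachine.State :=
      Sum.elim (fun p => ι (.inr ⟨b, p⟩)) ι
    have hb : ((a b).seq (.loop r a)).maxReg ≤ max c.maxReg 1 := by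
      cases b <;> simp_all [maxReg]
    rw [← ih hb ι' e (by rintro (p | p) <;> exact hι _)]
    refine congrArg (Machine.run _ _ _) ((step_pop_cons hr (hι (.inl ())) h x).trans ?_)
    cases b <;> rfl

theorem Exec.run_toMachine {s' : Store} {g : List Bool} (h : Exec O c s g s') :
    c.toMachine.run O g (c.cfg c.toMachine.start s) = c.cfg (.inr none) s' :=
  h.run_eq (le_max_left _ _) Sum.inl (.inr none) fun _ => rfl

theorem run_toMachine_concat {s' : Store} {g : List Bool} (h : Exec O c s g s') (x : Bool) :
    c.toMachine.run O (g ++ [x]) (c.cfg c.toMachine.start s) =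
      c.cfg (.inr (some ((s' 1).headD false))) (Function.update s' 1 (s' 1).tail) := by
  rw [Machine.run, List.foldl_append]
  refine (congrArg (c.toMachine.step O · x) h.run_toMachine).trans ?_
  rcases hs : s' 1 with _ | ⟨b, l⟩
  · refine (step_pop_nil (le_max_right _ _) rfl hs x).trans ?_
    rw [List.tail_nil, ← hs, Function.update_eq_self, hs]
    rfl
  · refine (step_pop_cons (le_max_right _ _) rfl hs x).trans ?_
    cases b <;> rfl

end Compilation

end Cmd

/-! ### Membership in the classes -/

/-- Replaces a query by the jump to its negative answer, which is encoded as a vacuous choice. -/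
def Instr.dropQuery {Q K : Type} : Instr Q K → Instr Q K
  | query _ _ qno => guess qno qno
  | i => i

/-- Replaces a choice by the jump to its first alternative, which is encoded as a vacuous query. -/
def Instr.dropGuess {Q K : Type} (k : K) : Instr Q K → Instr Q K
  | guess q₀ _ => query k q₀ q₀
  | i => i

theorem Instr.dropQuery_eq_halt {Q K : Type} {i : Instr Q K} {a : Bool} :
    i.dropQuery = .halt a ↔ i = .halt a := by
  cases i <;> simp [dropQuery]

theorem Instr.dropQuery_ne_query {Q K : Type} (i : Instr Q K) (k : K) (q q' : Q) :
    i.dropQuery ≠ .query k q q' := by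
  cases i <;> simp [dropQuery]

theorem Instr.dropGuess_ne_guess {Q K : Type} (k : K) (i : Instr Q K) (q q' : Q) :
    i.dropGuess k ≠ .guess q q' := by
  cases i <;> simp [dropGuess]

namespace Machine

variable {M : Machine} {O : Language Bool}

theorem run_append (g g' : List Bool) (c : M.Cfg) :
    M.run O (g ++ g') c = M.run O g' (M.run O g c) :=
  List.foldl_append

theorem Cfg.Halted.run_eq {c : M.Cfg} (h : c.Halted) (g : List Bool) : M.run O g c = c := by
  obtain ⟨a, ha⟩ := h
  induction g with
  | nil => rfl
  | cons b g ih =>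
    have hb : M.step O c b = c := by simp only [step, ha]
    rwa [run, List.foldl_cons, hb]

/-- The machine `M` with every instruction `i` replaced by `f i`. -/
def mapInstr (M : Machine) (f : Instr M.State M.Stack → Instr M.State M.Stack) : Machine :=
  { M with prog := fun q => f (M.prog q) }

/-- A configuration of `M`, as a configuration of `M.mapInstr f`. -/
def Cfg.mapInstr (c : M.Cfg) (f : Instr M.State M.Stack → Instr M.State M.Stack) :
    (M.mapInstr f).Cfg :=
  ⟨c.state, c.stk⟩

theorem run_mapInstr {f : Instr M.State M.Stack → Instr M.State M.Stack} {φ : Bool → Bool}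
    (h : ∀ (c : M.Cfg) b, (M.mapInstr f).step O (c.mapInstr f) b = (M.step O c (φ b)).mapInstr f)
    (g : List Bool) (c : M.Cfg) :
    (M.mapInstr f).run O g (c.mapInstr f) = (M.run O (g.map φ) c).mapInstr f := by
  induction g generalizing c with
  | nil => rfl
  | cons b g ih => exact (congrArg (run _ O g) (h c b)).trans (ih _)

theorem step_mapInstr_of_eq {f : Instr M.State M.Stack → Instr M.State M.Stack} {c : M.Cfg}
    (h : f (M.prog c.state) = M.prog c.state) (b : Bool) :
    (M.mapInstr f).step O (c.mapInstr f) b = (M.step O c b).mapInstr f := by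
  have h' : (M.mapInstr f).prog (c.mapInstr f).state = M.prog c.state := h
  unfold step
  rw [h']
  rcases M.prog c.state with _ | ⟨k, _, _, _⟩ | _ | _ | _ <;> try rfl
  rcases hk : c.stk k with _ | ⟨_ | _, _⟩ <;> simp only [Cfg.mapInstr, hk] <;> rfl

theorem run_dropQuery (g : List Bool) (c : M.Cfg) :
    (M.mapInstr .dropQuery).run ⊥ g (c.mapInstr _) = (M.run ⊥ g c).mapInstr .dropQuery := by
  refine (run_mapInstr (φ := id) (fun c b => ?_) g c).trans (by rw [List.map_id])
  rcases hi : M.prog c.state with _ | _ | _ | ⟨k, q, q'⟩ | _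
  case query =>
    have hk : c.stk k ∉ (⊥ : Language Bool) := id
    simp [step, mapInstr, Cfg.mapInstr, Instr.dropQuery, hi, hk]
  all_goals exact step_mapInstr_of_eq (by rw [hi]; rfl) b

theorem run_dropGuess (k : M.Stack) (g : List Bool) (c : M.Cfg) :
    (M.mapInstr (.dropGuess k)).run O g (c.mapInstr _) =
      (M.run O (g.map fun _ => false) c).mapInstr (.dropGuess k) := by
  refine run_mapInstr (fun c b => ?_) g c
  rcases hi : M.prog c.state with _ | _ | _ | _ | _
  case guess =>
    simp only [step, mapInstr, Cfg.mapInstr, Instr.dropGuess, hi]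
    exact congrArg (fun q => (⟨q, c.stk⟩ : (M.mapInstr (.dropGuess k)).Cfg)) (ite_self _)
  all_goals
    refine (step_mapInstr_of_eq (by rw [hi]; rfl) b).trans ?_
    simp only [step, hi]

end Machine

theorem mem_NE_of_machine (M : Machine) {L : Language Bool} (t : ℕ)
    (hM : ∀ x : List Bool,
      M.HaltsWithin ⊥ x (t * 2 ^ (t * x.length)) ∧ (x ∈ L ↔ M.Accepts ⊥ x)) : L ∈ NE := by
  have hrun (g x : List Bool) :
      (M.mapInstr .dropQuery).run ⊥ g ((M.mapInstr .dropQuery).init x) =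
        (M.run ⊥ g (M.init x)).mapInstr .dropQuery := M.run_dropQuery g (M.init x)
  refine ⟨M.mapInstr .dropQuery, fun q => (M.prog q).dropQuery_ne_query, t,
    fun x => ⟨fun g hg => ?_, ?_⟩⟩
  · rw [hrun]
    obtain ⟨a, ha⟩ := (hM x).1 g hg
    exact ⟨a, Instr.dropQuery_eq_halt.mpr ha⟩
  · refine (hM x).2.trans (exists_congr fun g => ?_)
    rw [hrun]
    exact Instr.dropQuery_eq_halt.symm

theorem mem_FPWith_of_machine (M : Machine) {O : Language Bool} {f : List Bool → List Bool}
    (p : Polynomial ℕ)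
    (hM : ∀ x g : List Bool, g.length = p.eval x.length →
      (M.run O g (M.init x)).Halted ∧ (M.run O g (M.init x)).stk M.out = f x) : f ∈ FPWith O := by
  refine ⟨M.mapInstr (.dropGuess M.inp), fun q => (M.prog q).dropGuess_ne_guess _, p,
    fun x g hg => ?_⟩
  have hrun : (M.mapInstr (.dropGuess M.inp)).run O g ((M.mapInstr (.dropGuess M.inp)).init x) =
      (M.run O (g.map fun _ => false) (M.init x)).mapInstr (.dropGuess M.inp) :=
    M.run_dropGuess M.inp g (M.init x)
  rw [hrun]
  obtain ⟨⟨a, ha⟩, hout⟩ := hM x (g.map fun _ => false) (by rwa [List.length_map])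
  exact ⟨⟨a, congrArg (Instr.dropGuess M.inp) ha⟩, hout⟩

namespace Cmd

/-! ### Execution within a time bound -/

variable {O : Language Bool} {c c' : Cmd} {s s' : Store} {T T' : ℕ} {S : Set Store}

/-- Within `T` steps every computation path of `c` leads from `s` to some store in `S`, and every
store in `S` is reached on some path. -/
def Reaches (O : Language Bool) (c : Cmd) (s : Store) (T : ℕ) (S : Set Store) : Prop :=
  (∀ g : List Bool, T ≤ g.length → ∃ s' ∈ S, ∃ g₁, g₁ <+: g ∧ Exec O c s g₁ s') ∧
    ∀ s' ∈ S, ∃ g, Exec O c s g s'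

/-- Within `T` steps every computation path of `c` leads from `s` to `s'`. -/
abbrev Computes (O : Language Bool) (c : Cmd) (s : Store) (T : ℕ) (s' : Store) : Prop :=
  Reaches O c s T {s'}

theorem Reaches.mono (h : Reaches O c s T S) (hT : T ≤ T') : Reaches O c s T' S :=
  ⟨fun g hg => h.1 g (hT.trans hg), h.2⟩

theorem Reaches.of_exec_cons (h : Reaches O c s T S) {s₀ : Store}
    (hc : ∀ x g s', Exec O c s g s' → Exec O c' s₀ (x :: g) s') : Reaches O c' s₀ (T + 1) S := by
  refine ⟨fun g hg => ?_, fun s' hs' => ?_⟩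
  · rcases g with _ | ⟨x, g⟩
    · simp at hg
    · obtain ⟨s', hs', g₁, hg₁, he⟩ := h.1 g (by simpa using hg)
      exact ⟨s', hs', x :: g₁, (List.prefix_cons_inj x).mpr hg₁, hc x g₁ s' he⟩
  · obtain ⟨g, he⟩ := h.2 s' hs'
    exact ⟨true :: g, hc true g s' he⟩

theorem computes_skip (s : Store) : Computes O skip s 0 s :=
  ⟨fun g _ => ⟨s, rfl, [], g.nil_prefix, .skip s⟩, by rintro _ rfl; exact ⟨[], .skip _⟩⟩

theorem computes_of_exec_singleton (h : ∀ x, Exec O c s [x] s') : Computes O c s 1 s' := by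
  refine ⟨fun g hg => ?_, by rintro _ rfl; exact ⟨[true], h true⟩⟩
  rcases g with _ | ⟨x, g⟩
  · simp at hg
  · exact ⟨s', rfl, [x], by simp, h x⟩

theorem computes_push (r : ℕ) (b : Bool) (s : Store) :
    Computes O (push r b) s 1 (Function.update s r (b :: s r)) :=
  computes_of_exec_singleton fun x => .push r b s x

theorem Reaches.biUnion_seq {T₁ T₂ : ℕ} {F : Store → Set Store} (h : Reaches O c s T₁ S)
    (h' : ∀ s₁ ∈ S, Reaches O c' s₁ T₂ (F s₁)) :
    Reaches O (seq c c') s (T₁ + T₂) (⋃ s₁ ∈ S, F s₁) := by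
  refine ⟨fun g hg => ?_, fun s₂ hs₂ => ?_⟩
  · obtain ⟨s₁, hs₁, g₁, hg₁, he₁⟩ := h.1 (g.take T₁) (by simp; omega)
    obtain ⟨r, rfl⟩ := hg₁.trans (List.take_prefix T₁ g)
    have hlen : g₁.length ≤ T₁ := hg₁.length_le.trans (List.length_take_le ..)
    obtain ⟨s₂, hs₂, g₂, hg₂, he₂⟩ := (h' s₁ hs₁).1 r (by simp at hg; omega)
    exact ⟨s₂, Set.mem_biUnion hs₁ hs₂, g₁ ++ g₂, (List.prefix_append_right_inj g₁).mpr hg₂,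
      he₁.seq he₂⟩
  · obtain ⟨s₁, hs₁, hs₂⟩ := Set.mem_iUnion₂.mp hs₂
    obtain ⟨g₁, he₁⟩ := h.2 s₁ hs₁
    obtain ⟨g₂, he₂⟩ := (h' s₁ hs₁).2 s₂ hs₂
    exact ⟨g₁ ++ g₂, he₁.seq he₂⟩

theorem Reaches.seq {s₁ : Store} {T₁ T₂ : ℕ} (h : Computes O c s T₁ s₁)
    (h' : Reaches O c' s₁ T₂ S) : Reaches O (seq c c') s (T₁ + T₂) S := by
  have := Reaches.biUnion_seq (F := fun _ => S) h fun s' hs' => Set.mem_singleton_iff.mp hs' ▸ h'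
  rwa [Set.biUnion_singleton] at this

theorem Reaches.popNil {r : ℕ} {c : Bool → Cmd} (h : s r = []) (hc : Reaches O c' s T S) :
    Reaches O (pop r c' c) s (T + 1) S :=
  hc.of_exec_cons fun x _ _ => .popNil x h

theorem Reaches.popCons {r : ℕ} {c : Bool → Cmd} {b : Bool} {l : List Bool} (h : s r = b :: l)
    (hc : Reaches O (c b) (Function.update s r l) T S) : Reaches O (pop r c' c) s (T + 1) S :=
  hc.of_exec_cons fun x _ _ => .popCons x h

theorem Reaches.query {r : ℕ} {c : Bool → Cmd} {b : Bool} (h : b = true ↔ s r ∈ O)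
    (hc : Reaches O (c b) s T S) : Reaches O (query r c) s (T + 1) S :=
  hc.of_exec_cons fun x _ _ => .query x h

theorem computes_loop_nil {r : ℕ} {c : Bool → Cmd} (h : s r = []) : Computes O (loop r c) s 1 s :=
  computes_of_exec_singleton fun x => .loopNil x h

theorem Reaches.loopCons {r : ℕ} {c : Bool → Cmd} {b : Bool} {l : List Bool} (h : s r = b :: l)
    (hc : Reaches O (Cmd.seq (c b) (loop r c)) (Function.update s r l) T S) :
    Reaches O (loop r c) s (T + 1) S :=
  hc.of_exec_cons fun x _ _ => .loopCons x h

theorem Reaches.guess {c : Bool → Cmd} {F : Bool → Set Store}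
    (h : ∀ b, Reaches O (c b) s T (F b)) : Reaches O (guess c) s (T + 1) (⋃ b, F b) := by
  refine ⟨fun g hg => ?_, fun s' hs' => ?_⟩
  · rcases g with _ | ⟨b, g⟩
    · simp at hg
    · obtain ⟨s', hs', g₁, hg₁, he⟩ := (h b).1 g (by simpa using hg)
      exact ⟨s', Set.mem_iUnion_of_mem b hs', b :: g₁, (List.prefix_cons_inj b).mpr hg₁,
        he.guess b⟩
  · obtain ⟨b, hs'⟩ := Set.mem_iUnion.mp hs'
    obtain ⟨g, he⟩ := (h b).2 s' hs'
    exact ⟨b :: g, he.guess b⟩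

/-- The store with input `x`. -/
def input (x : List Bool) : Store := Function.update (fun _ => []) 0 x

theorem cfg_input (c : Cmd) (x : List Bool) :
    c.cfg c.toMachine.start (input x) = c.toMachine.init x :=
  congrArg (Machine.Cfg.mk _)
    ((update_comp_val (Nat.zero_le _) x).trans (funext fun _ : Fin _ => Function.update_apply ..))

theorem Reaches.run_toMachine {x g : List Bool} (h : Reaches O c (input x) T S)
    (hg : T + 1 ≤ g.length) :
    ∃ s' ∈ S, c.toMachine.run O g (c.toMachine.init x) =
      c.cfg (.inr (some ((s' 1).headD false))) (Function.update s' 1 (s' 1).tail) := by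
  obtain ⟨s', hs', g₁, hg₁, he⟩ := h.1 (g.take T) (by simp; omega)
  have hlen : g₁.length ≤ T := hg₁.length_le.trans (List.length_take_le ..)
  obtain ⟨r, rfl⟩ := hg₁.trans (List.take_prefix T g)
  rcases r with _ | ⟨y, r⟩
  · simp at hg
    omega
  refine ⟨s', hs', ?_⟩
  rw [List.append_cons, Machine.run_append, ← cfg_input, run_toMachine_concat he]
  exact Machine.Cfg.Halted.run_eq ⟨_, rfl⟩ r

theorem mem_NE_of_reaches {L : Language Bool} {S : List Bool → Set Store} {t : ℕ}
    (h : ∀ x : List Bool, Reaches ⊥ c (input x) (t * 2 ^ (t * x.length)) (S x))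
    (hL : ∀ x, x ∈ L ↔ ∃ s ∈ S x, (s 1).headD false = true) : L ∈ NE := by
  have ht (n : ℕ) : t * 2 ^ (t * n) + 1 ≤ (t + 1) * 2 ^ ((t + 1) * n) := calc
    _ ≤ t * 2 ^ ((t + 1) * n) + 1 * 2 ^ ((t + 1) * n) := by
      gcongr
      · norm_num
      · omega
      · simpa using Nat.one_le_two_pow
    _ = _ := by ring
  refine mem_NE_of_machine c.toMachine (t + 1) fun x => ⟨fun g hg => ?_, ?_⟩
  · obtain ⟨s, -, hs⟩ := (h x).run_toMachine (hg ▸ ht x.length)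
    rw [hs]
    exact ⟨_, rfl⟩
  rw [hL]
  constructor
  · rintro ⟨s, hs, hacc⟩
    obtain ⟨g, he⟩ := (h x).2 s hs
    refine ⟨g ++ [true], ?_⟩
    rw [← cfg_input, run_toMachine_concat he, hacc]
    rfl
  · rintro ⟨g, hg⟩
    let r := List.replicate (t * 2 ^ (t * x.length) + 1) true
    obtain ⟨s, hs, hrun⟩ := (h x).run_toMachine (g := g ++ r) (by simp [r])
    refine ⟨s, hs, ?_⟩
    rw [Machine.run_append, Machine.Cfg.Halted.run_eq ⟨_, hg⟩] at hrun
    rw [hrun] at hg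
    exact Instr.halt.inj hg

theorem mem_FPWith_of_computes {f : List Bool → List Bool} {s : List Bool → Store}
    (p : Polynomial ℕ) (h : ∀ x, Computes O c (input x) (p.eval x.length) (s x))
    (hf : ∀ x, s x 0 = f x) : f ∈ FPWith O := by
  refine mem_FPWith_of_machine c.toMachine (p + 1) fun x g hg => ?_
  obtain ⟨_, rfl, hs⟩ := (h x).run_toMachine (g := g) (by simp [hg])
  rw [hs]
  refine ⟨⟨_, rfl⟩, ?_⟩
  exact (Function.update_of_ne zero_ne_one (s x 1).tail (s x)).trans (hf x)

end Cmd

namespace Cmd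

variable {O : Language Bool} {c : Cmd} {s s' s'' : Store} {T T' : ℕ} {S : Set Store} {i j k : ℕ}

theorem Reaches.congr (h : Computes O c s T s') (hs : s' = s'') (hT : T ≤ T') :
    Computes O c s T' s'' :=
  hs ▸ h.mono hT

/-! ### Moving and copying registers -/

/-- Clears register `i`. -/
def clr (i : ℕ) : Cmd := loop i fun _ => skip

/-- Moves the bits of `i` to `j`, in reverse order. -/
def mv (i j : ℕ) : Cmd := loop i (push j)

/-- Moves the bits of `i` to `j`, in the same order, through the empty register `k`. -/
def mv₂ (i j k : ℕ) : Cmd := seq (mv i k) (mv k j)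

/-- Moves the bits of `k` to both `i` and `j`, in reverse order. -/
def unzip (k i j : ℕ) : Cmd := loop k fun b => seq (push i b) (push j b)

/-- Copies `i` to the empty register `j`, through the empty register `k`. -/
def dup (i j k : ℕ) : Cmd := seq (mv i k) (unzip k i j)

theorem computes_clr (i : ℕ) (s : Store) :
    Computes O (clr i) s ((s i).length + 1) (Function.update s i []) := by
  generalize hl : s i = l
  induction l generalizing s with
  | nil => exact (computes_loop_nil hl).congr (by simp [← hl]) (by simp)
  | cons b l ih =>
    exact (Reaches.loopCons hl ((computes_skip _).seq (ih _ (by simp)))).congr (by simp) (by simp)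

theorem computes_mv (hij : i ≠ j) (s : Store) :
    Computes O (mv i j) s (2 * (s i).length + 1)
      (Function.update (Function.update s i []) j ((s i).reverse ++ s j)) := by
  generalize hl : s i = l
  induction l generalizing s with
  | nil => exact (computes_loop_nil hl).congr (by grind [Function.update_apply]) (by simp)
  | cons b l ih =>
    refine (Reaches.loopCons hl ((computes_push j b _).seq (ih _ ?_))).congr ?_ (by grind)
    · simp [hij]
    · grind [Function.update_apply]

theorem computes_mv₂ (hij : i ≠ j) (hik : i ≠ k) (hjk : j ≠ k) (hk : s k = []) :
    Computes O (mv₂ i j k) s (4 * (s i).length + 2)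
      (Function.update (Function.update s i []) j (s i ++ s j)) := by
  refine ((computes_mv hik s).seq (computes_mv hjk.symm _)).congr ?_ ?_
  · grind [Function.update_apply]
  · simp [hk]
    omega

theorem computes_unzip (hij : i ≠ j) (hik : i ≠ k) (hjk : j ≠ k) (s : Store) :
    Computes O (unzip k i j) s (3 * (s k).length + 1)
      (Function.update (Function.update (Function.update s k []) i ((s k).reverse ++ s i)) j
        ((s k).reverse ++ s j)) := by
  generalize hl : s k = l
  induction l generalizing s with
  | nil => exact (computes_loop_nil hl).congr (by grind [Function.update_apply]) (by simp)
  | cons b l ih =>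
    refine (Reaches.loopCons hl (((computes_push i b _).seq (computes_push j b _)).seq
      (ih _ ?_))).congr ?_ (by grind)
    · simp [hik.symm, hjk.symm]
    · grind [Function.update_apply]

theorem computes_dup (hij : i ≠ j) (hik : i ≠ k) (hjk : j ≠ k) (hj : s j = []) (hk : s k = []) :
    Computes O (dup i j k) s (5 * (s i).length + 2) (Function.update s j (s i)) := by
  refine ((computes_mv hik s).seq (computes_unzip hij hik hjk _)).congr ?_ ?_
  · grind [Function.update_apply]
  · simp [hk]
    omega

end Cmd

/-! ### Binary trees and their codes -/

/-- Binary trees, the data on which programs operate. -/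
inductive Dat where
  | nil
  | cons (a b : Dat)

namespace Dat

/-- The number of inner nodes. -/
def size : Dat → ℕ
  | nil => 0
  | cons a b => size a + size b + 1

/-- The prefix code of a tree. -/
def code : Dat → List Bool
  | nil => [false]
  | cons a b => true :: (code a ++ code b)

/-- The left subtree. -/
def hd : Dat → Dat
  | nil => nil
  | cons a _ => a

/-- The right subtree. -/
def tl : Dat → Dat
  | nil => nil
  | cons _ b => b

theorem size_hd_le (t : Dat) : t.hd.size ≤ t.size := by
  cases t <;> simp [hd, size]; omega

theorem size_tl_le (t : Dat) : t.tl.size ≤ t.size := by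
  cases t <;> simp [tl, size]; omega

theorem length_code (t : Dat) : t.code.length = 2 * t.size + 1 := by
  induction t with
  | nil => rfl
  | cons a b iha ihb => simp [code, size, iha, ihb]; omega

theorem count_code (t : Dat) : t.code.count true = t.size := by
  induction t with
  | nil => rfl
  | cons a b iha ihb => simp [code, size, iha, ihb]

/-- Reads `c` trees from a bit string, which is continued by zeros if necessary; the second
component is the unread part. -/
def parse : List Bool → ℕ → List Dat × List Bool
  | x, 0 => ([], x)
  | [], c + 1 => (nil :: (parse [] c).1, (parse [] c).2)
  | false :: x, c + 1 => (nil :: (parse x c).1, (parse x c).2)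
  | true :: x, c + 1 =>
    let p := parse x (c + 2)
    (cons (p.1.headD nil) (p.1.tail.headD nil) :: p.1.tail.tail, p.2)

theorem length_parse (x : List Bool) (c : ℕ) : (parse x c).1.length = c := by
  fun_induction parse <;> simp_all +zetaDelta

theorem parse_code_append (t : Dat) (x : List Bool) (c : ℕ) :
    parse (t.code ++ x) (c + 1) = (t :: (parse x c).1, (parse x c).2) := by
  induction t generalizing x c with
  | nil => simp [code, parse]
  | cons a b iha ihb => simp [code, parse, iha, ihb]

theorem flatMap_code_parse_true_cons (x : List Bool) (c : ℕ) :
    (parse (true :: x) (c + 1)).1.flatMap code = true :: (parse x (c + 2)).1.flatMap code := by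
  match h : (parse x (c + 2)).1, length_parse x (c + 2) with
  | a :: b :: ts, _ => simp [parse, code, h]

theorem length_code_parse_le (x : List Bool) (c : ℕ) :
    ((parse x c).1.flatMap code).length ≤ 2 * x.length + c := by
  fun_induction parse x c with
  | case1 => simp
  | case2 c ih => simp_all [code]
  | case3 x c ih => simp_all [code]; omega
  | case4 x c _ ih =>
    have := congrArg List.length (flatMap_code_parse_true_cons x c)
    grind [parse]

theorem length_parse_snd_le (x : List Bool) (c : ℕ) : (parse x c).2.length ≤ x.length := by
  fun_induction parse <;> grind

/-- The tree at the beginning of a bit string, which is continued by zeros if necessary. -/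
def ofCode (x : List Bool) : Dat := (parse x 1).1.headD nil

theorem ofCode_code_append (t : Dat) (x : List Bool) : ofCode (t.code ++ x) = t := by
  simp [ofCode, parse_code_append]

theorem ofCode_code (t : Dat) : ofCode t.code = t := by
  simpa using ofCode_code_append t []

theorem parse_one (x : List Bool) : (parse x 1).1 = [ofCode x] := by
  match h : (parse x 1).1, length_parse x 1 with
  | [a], _ => simp [ofCode, h]

theorem size_ofCode_le (x : List Bool) : (ofCode x).size ≤ x.length := by
  have := length_code_parse_le x 1
  simp only [parse_one, List.flatMap_singleton, length_code] at this
  omega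

end Dat

namespace Cmd

variable {O : Language Bool} {s : Store} {i j k : ℕ}

/-! ### Reading trees from registers -/

/-- Moves a node from `i` to `j`, where `k` counts the trees that are still to be read. -/
def parseStep (i j k : ℕ) : Cmd :=
  pop i (push j false) fun b =>
    bif b then seq (push j true) (seq (push k true) (push k true)) else push j false

/-- Moves codes of trees from `i` to `j` (in reverse order), one for each bit of `k`. -/
def parseLoop (i j k : ℕ) : Cmd := loop k fun _ => parseStep i j k

/-- Moves the first tree from `i` to the empty register `j` (in reverse order), where `k` is
empty. -/
def parse (i j k : ℕ) : Cmd := seq (push k true) (parseLoop i j k)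

theorem computes_parseStep_of_false (hij : i ≠ j) (h : (s i).headD false = false) :
    Computes O (parseStep i j k) s 2
      (Function.update (Function.update s i (s i).tail) j (false :: s j)) := by
  match hi : s i with
  | [] =>
    have hs : Function.update s i [] = s := by rw [← hi, Function.update_eq_self]
    rw [List.tail_nil, hs]
    exact Reaches.popNil hi (computes_push j false s)
  | true :: x => simp [hi] at h
  | false :: x =>
    have := computes_push (O := O) j false (Function.update s i x)
    rw [Function.update_of_ne hij.symm] at this
    exact Reaches.popCons hi this

theorem computes_parseStep_of_true (hij : i ≠ j) (hik : i ≠ k) (hjk : j ≠ k) {x : List Bool}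
    (h : s i = true :: x) :
    Computes O (parseStep i j k) s 4 (Function.update (Function.update (Function.update s i x) j
      (true :: s j)) k (true :: true :: s k)) :=
  (Reaches.popCons h ((computes_push ..).seq ((computes_push ..).seq (computes_push ..)))).congr
    (by grind [Function.update_apply]) le_rfl

theorem computes_parseLoop (hij : i ≠ j) (hik : i ≠ k) (hjk : j ≠ k) (x : List Bool) (c : ℕ)
    (s : Store) (hi : s i = x) (hk : s k = List.replicate c true) :
    Computes O (parseLoop i j k) s (5 * ((Dat.parse x c).1.flatMap Dat.code).length + 1)
      (Function.update (Function.update (Function.update s k []) i (Dat.parse x c).2) j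
        (((Dat.parse x c).1.flatMap Dat.code).reverse ++ s j)) := by
  fun_induction Dat.parse x c generalizing s with
  | case1 x => exact (computes_loop_nil hk).congr (by grind [Function.update_apply]) (by simp)
  | case2 c ih | case3 x c ih =>
    refine (Reaches.loopCons hk ((computes_parseStep_of_false hij ?_).seq (ih _ ?_ ?_))).congr ?_ ?_
    all_goals grind [Function.update_apply, Dat.code]
  | case4 x c _ ih =>
    have hcode := Dat.flatMap_code_parse_true_cons x c
    simp only [Dat.parse] at hcode
    rw [hcode]
    refine (Reaches.loopCons hk ((computes_parseStep_of_true hij hik hjk (x := x) ?_).seq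
      (ih _ ?_ ?_))).congr ?_ ?_
    all_goals grind [Function.update_apply]

theorem computes_parse (hij : i ≠ j) (hik : i ≠ k) (hjk : j ≠ k) (hj : s j = []) (hk : s k = []) :
    Computes O (parse i j k) s (5 * (Dat.ofCode (s i)).code.length + 2)
      (Function.update (Function.update s i (Dat.parse (s i) 1).2) j
        (Dat.ofCode (s i)).code.reverse) := by
  refine ((computes_push k true s).seq
    (computes_parseLoop hij hik hjk (s i) 1 _ (by simp [hik]) (by simp [hk]))).congr ?_ ?_
  all_goals grind [Function.update_apply, Dat.parse_one]

/-- Reduces `i` to the code of its first tree. -/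
def readTree (i j k : ℕ) : Cmd := seq (parse i j k) (seq (clr i) (mv j i))

/-- Removes the first tree from `i`. -/
def dropTree (i j k : ℕ) : Cmd := seq (parse i j k) (clr j)

theorem computes_readTree (hij : i ≠ j) (hik : i ≠ k) (hjk : j ≠ k) (hj : s j = [])
    (hk : s k = []) :
    Computes O (readTree i j k) s (15 * (s i).length + 11)
      (Function.update s i (Dat.ofCode (s i)).code) := by
  refine ((computes_parse hij hik hjk hj hk).seq
    ((computes_clr i _).seq (computes_mv hij.symm _))).congr ?_ ?_
  · grind [Function.update_apply]
  · have := Dat.length_code_parse_le (s i) 1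
    have := Dat.length_parse_snd_le (s i) 1
    grind [Function.update_apply, Dat.parse_one]

theorem computes_dropTree (hij : i ≠ j) (hik : i ≠ k) (hjk : j ≠ k) (hj : s j = [])
    (hk : s k = []) {t : Dat} {x : List Bool} (h : s i = t.code ++ x) :
    Computes O (dropTree i j k) s (12 * t.size + 9) (Function.update s i x) := by
  refine ((computes_parse hij hik hjk hj hk).seq (computes_clr j _)).congr ?_ ?_
  all_goals
    simp only [h, Dat.ofCode_code_append, Dat.parse_code_append, Dat.parse]
    grind [Function.update_apply, Dat.length_code]

end Cmd

/-! ### Tree programs -/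

/-- Programs for functions on trees. -/
inductive Fn where
  | id
  | nil
  | pair (f g : Fn)
  | hd
  | tl
  | comp (g f : Fn)
  /-- on `cons b x`, apply `f` to `x` if `b = nil` and `g` to `x` otherwise -/
  | branch (f g : Fn)
  /-- on `cons n x`, iterate `f` on `x`, as often as `n` has inner nodes -/
  | iter (f : Fn)
  /-- ask whether the code of the tree is in the oracle -/
  | query

namespace Fn

open Classical in
/-- The function computed by a tree program. -/
noncomputable def eval (O : Language Bool) : Fn → Dat → Dat
  | id, v => v
  | nil, _ => .nil
  | pair f g, v => .cons (f.eval O v) (g.eval O v)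
  | hd, v => v.hd
  | tl, v => v.tl
  | comp g f, v => g.eval O (f.eval O v)
  | branch f g, v =>
    match v with
    | .nil => .nil
    | .cons .nil x => f.eval O x
    | .cons (.cons _ _) x => g.eval O x
  | iter f, v =>
    match v with
    | .nil => .nil
    | .cons n x => (f.eval O)^[n.size] x
  | query, v => if v.code ∈ O then .cons .nil .nil else .nil

/-- The total cost of iterating `f`, where a single application costs `c`. -/
def iterCost (f : Dat → Dat) (c : Dat → ℕ) : ℕ → Dat → ℕ
  | 0, x => x.size
  | n + 1, x => c x + iterCost f c n (f x)

/-- A bound for the running time of the stack program for `f`. -/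
noncomputable def cost (O : Language Bool) : Fn → Dat → ℕ
  | id, v => v.size
  | nil, v => 4 * (v.size + 1)
  | pair f g, v => f.cost O v + g.cost O v +
      30 * (v.size + (f.eval O v).size + (g.eval O v).size + 1)
  | hd, v => 30 * (v.size + 1)
  | tl, v => 30 * (v.size + 1)
  | comp g f, v => f.cost O v + g.cost O (f.eval O v)
  | branch f g, v =>
    30 * (v.size + 1) +
    match v with
    | .nil => 0
    | .cons .nil x => f.cost O x
    | .cons (.cons _ _) x => g.cost O x
  | iter f, v =>
    30 * (v.size + 1) +
    match v with
    | .nil => 0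
    | .cons n x => 30 * iterCost (f.eval O) (f.cost O) n.size x
  | query, v => 30 * (v.size + 1)

theorem size_iterate_le_iterCost (f : Dat → Dat) (c : Dat → ℕ) (n : ℕ) (x : Dat) :
    (f^[n] x).size ≤ iterCost f c n x := by
  induction n generalizing x with
  | zero => exact le_rfl
  | succ n ih => exact (ih (f x)).trans (Nat.le_add_left _ _)

theorem size_eval_le_cost (O : Language Bool) (f : Fn) (v : Dat) :
    (f.eval O v).size ≤ f.cost O v := by
  induction f generalizing v with
  | id => exact le_rfl
  | nil => exact Nat.zero_le _
  | pair f g => simp only [eval, Dat.size, cost]; omega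
  | hd => exact v.size_hd_le.trans (by simp only [cost]; omega)
  | tl => exact v.size_tl_le.trans (by simp only [cost]; omega)
  | comp g f ihg => exact (ihg _).trans (Nat.le_add_left _ _)
  | branch f g ihf ihg =>
    match v with
    | .nil => exact Nat.zero_le _
    | .cons .nil x => exact (ihf x).trans (Nat.le_add_left _ _)
    | .cons (.cons _ _) x => exact (ihg x).trans (Nat.le_add_left _ _)
  | iter f =>
    match v with
    | .nil => exact Nat.zero_le _
    | .cons n x =>
      have := size_iterate_le_iterCost (f.eval O) (f.cost O) n.size x
      simp only [eval, cost]
      omega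
  | query =>
    simp only [eval, cost]
    split_ifs <;> simp only [Dat.size] <;> omega

end Fn

/-! ### Compilation of tree programs -/

namespace Cmd

variable {O : Language Bool} {c c' : Cmd} {d : ℕ} {F G : Dat → Dat} {C D : Dat → ℕ}

/-- The program `c` computes `F` in time `C` on the code of a tree in register `d`, provided that
the registers above `d` are empty. -/
def Implements (O : Language Bool) (c : Cmd) (d : ℕ) (F : Dat → Dat) (C : Dat → ℕ) : Prop :=
  ∀ (s : Store) (v : Dat), (∀ r > d, s r = []) → s d = v.code →
    Computes O c s (C v) (Function.update s d (F v).code)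

theorem Implements.mono (h : Implements O c d F C) (hCD : ∀ v, C v ≤ D v) : Implements O c d F D :=
  fun s v hs hv => (h s v hs hv).mono (hCD v)

theorem Implements.seq (hf : Implements O c d F C) (hg : Implements O c' d G D) :
    Implements O (seq c c') d (fun v => G (F v)) fun v => C v + D (F v) := fun s v hs hv =>
  ((hf s v hs hv).seq (hg _ (F v) (by grind [Function.update_apply]) (by simp))).congr
    (by simp) le_rfl

/-- Writes the code of the empty tree to `d`. -/
def setNil (d : ℕ) : Cmd := seq (clr d) (push d false)

/-- Writes the code of the tree with one node to `d`. -/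
def setTrue (d : ℕ) : Cmd := seq (setNil d) (seq (push d false) (push d true))

/-- Runs `c` on the codes of the two subtrees of the tree in `d`, unless this is the empty tree. -/
def onCons (d : ℕ) (c : Cmd) : Cmd := pop d skip fun b => bif b then c else push d false

/-- Replaces `d` by the tree with the left subtree in `d + 2` and the right subtree in `d + 1`. -/
def joinTrees (d : ℕ) : Cmd :=
  seq (clr d) <| seq (mv₂ (d + 1) d (d + 3)) <| seq (mv₂ (d + 2) d (d + 3)) <| push d true

/-- Pairs the result of `cf` in `d + 2` with that of `cg` in `d + 1`. -/
def pair (d : ℕ) (cf cg : Cmd) : Cmd :=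
  seq (dup d (d + 1) (d + 2)) <| seq cg <| seq (dup d (d + 2) (d + 3)) <| seq cf <| joinTrees d

/-- Branches on whether the left subtree in `d` is empty. -/
def branch (d : ℕ) (cf cg : Cmd) : Cmd :=
  onCons d <| pop d skip fun b =>
    bif b then seq (push d true) (seq (dropTree d (d + 1) (d + 2)) cg) else cf

/-- Splits the two codes in `d` into `d` and `d + 1`. -/
def split (d : ℕ) : Cmd :=
  seq (parse d (d + 1) (d + 2)) <| seq (mv d (d + 2)) <| seq (mv (d + 1) d) (mv (d + 2) (d + 1))

/-- Runs `c`, which works on `d + 1`, once for every true bit in `d`. -/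
def iterate (d : ℕ) (c : Cmd) : Cmd := loop d fun b => bif b then c else skip

theorem implements_setNil (d : ℕ) :
    Implements O (setNil d) d (fun _ => .nil) fun v => 4 * (v.size + 1) := fun s v _ hv =>
  ((computes_clr d s).seq (computes_push d false _)).congr (by simp [Dat.code])
    (by simp only [hv, Dat.length_code]; omega)

theorem implements_setTrue (d : ℕ) :
    Implements O (setTrue d) d (fun _ => .cons .nil .nil) fun v => 4 * (v.size + 1) + 2 :=
  fun s v hs hv => ((implements_setNil d s v hs hv).seq
    ((computes_push d false _).seq (computes_push d true _))).congr (by simp [Dat.code]) le_rfl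

theorem Implements.onCons (hF : F .nil = .nil)
    (h : ∀ (s : Store) (a b : Dat), (∀ r > d, s r = []) → s d = a.code ++ b.code →
      Computes O c s (C (.cons a b)) (Function.update s d (F (.cons a b)).code)) :
    Implements O (onCons d c) d F fun v => C v + 2 := fun s v hs hv => by
  match v with
  | .nil =>
    have hpush := computes_push (O := O) d false (Function.update s d [])
    rw [Function.update_self, Function.update_idem] at hpush
    rw [hF]
    exact Reaches.mono (Reaches.popCons hv hpush) (Nat.le_add_left 2 _)
  | .cons a b =>
    have hc := h (Function.update s d (a.code ++ b.code)) a b (by grind [Function.update_apply])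
      (by simp)
    rw [Function.update_idem] at hc
    exact Reaches.mono (Reaches.popCons hv hc) (Nat.le_succ _)

theorem implements_hd (d : ℕ) :
    Implements O (onCons d (readTree d (d + 1) (d + 2))) d Dat.hd fun v => 30 * (v.size + 1) := by
  refine (Implements.onCons (C := fun v => 30 * v.size + 11) rfl fun s a b hs hab => ?_).mono
    fun v => by omega
  refine (computes_readTree (by omega) (by omega) (by omega) (hs _ (by omega))
    (hs _ (by omega))).congr ?_ ?_
  · rw [hab, Dat.ofCode_code_append, Dat.hd]
  · simp only [hab, List.length_append, Dat.length_code, Dat.size]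
    omega

theorem implements_tl (d : ℕ) :
    Implements O (onCons d (dropTree d (d + 1) (d + 2))) d Dat.tl fun v => 30 * (v.size + 1) := by
  refine (Implements.onCons (C := fun v => 30 * v.size + 11) rfl fun s a b hs hab => ?_).mono
    fun v => by omega
  exact (computes_dropTree (by omega) (by omega) (by omega) (hs _ (by omega))
    (hs _ (by omega)) hab).mono (by simp only [Dat.size]; omega)

theorem computes_joinTrees {s : Store} {t a b : Dat} (hd : s d = t.code)
    (hb : s (d + 1) = b.code) (ha : s (d + 2) = a.code) (h₃ : s (d + 3) = []) :
    Computes O (joinTrees d) s (2 * t.size + 8 * a.size + 8 * b.size + 15)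
      (Function.update (Function.update (Function.update s (d + 1) []) (d + 2) []) d
        (Dat.cons a b).code) := by
  refine ((computes_clr d _).seq <| (computes_mv₂ ?_ ?_ ?_ ?_).seq <|
    (computes_mv₂ ?_ ?_ ?_ ?_).seq (computes_push d true _)).congr ?_ ?_
  all_goals grind [Function.update_apply, Dat.length_code, Dat.code]

theorem Implements.pair {cf cg : Cmd} (hf : Implements O cf (d + 2) F C)
    (hg : Implements O cg (d + 1) G D) :
    Implements O (pair d cf cg) d (fun v => .cons (F v) (G v))
      fun v => C v + D v + 30 * (v.size + (F v).size + (G v).size + 1) := fun s v hs hv => by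
  refine ((computes_dup ?_ ?_ ?_ ?_ ?_).seq <| (hg _ v ?_ ?_).seq <|
    (computes_dup ?_ ?_ ?_ ?_ ?_).seq <| (hf _ v ?_ ?_).seq <|
    computes_joinTrees (t := v) (a := F v) (b := G v) ?_ ?_ ?_ ?_).congr ?_ ?_
  all_goals grind [Function.update_apply, Dat.length_code]

theorem Implements.branch {cf cg : Cmd} (hf : Implements O cf d F C) (hg : Implements O cg d G D) :
    Implements O (branch d cf cg) d
      (fun v => match v with
        | .nil => .nil
        | .cons .nil x => F x
        | .cons (.cons _ _) x => G x)
      fun v => 30 * (v.size + 1) + match v with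
        | .nil => 0
        | .cons .nil x => C x
        | .cons (.cons _ _) x => D x := by
  refine (Implements.onCons (C := fun v => 28 * (v.size + 1) + match v with
    | .nil => 0
    | .cons .nil x => C x
    | .cons (.cons _ _) x => D x) rfl fun s a b hs hab => ?_).mono fun v => by omega
  match a with
  | .nil =>
    have := hf (Function.update s d b.code) b (by grind [Function.update_apply]) (by simp)
    rw [Function.update_idem] at this
    exact Reaches.mono (Reaches.popCons hab this) (by grind)
  | .cons a₁ a₂ =>
    have := (computes_push d true (Function.update s d (a₁.code ++ a₂.code ++ b.code))).seq <|
      (computes_dropTree (t := .cons a₁ a₂) (x := b.code) (show d ≠ d + 1 by omega)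
        (show d ≠ d + 2 by omega) (by omega) (by grind [Function.update_apply])
        (by grind [Function.update_apply]) (by simp [Dat.code])).seq
      (hg _ b (by grind [Function.update_apply]) (by simp))
    simp only [Function.update_idem] at this
    exact Reaches.mono (Reaches.popCons hab this) (by grind [Dat.size])

theorem computes_split {s : Store} {t : Dat} {x : List Bool} (hs : ∀ r > d, s r = [])
    (hd : s d = t.code ++ x) :
    Computes O (split d) s (14 * t.code.length + 6 * x.length + 10)
      (Function.update (Function.update s d t.code) (d + 1) x) := by
  have hparse := computes_parse (O := O) (show d ≠ d + 1 by omega) (show d ≠ d + 2 by omega)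
    (by omega) (hs _ (by omega)) (hs _ (by omega))
  rw [hd, Dat.ofCode_code_append, Dat.parse_code_append] at hparse
  refine (hparse.seq <| (computes_mv ?_ _).seq <| (computes_mv ?_ _).seq
    (computes_mv ?_ _)).congr (funext fun r => ?_) ?_
  case refine_4 =>
    simp only [Function.update_apply, Dat.parse]
    grind
  all_goals grind [Function.update_apply, Dat.parse]

theorem computes_iterate (hc : Implements O c (d + 1) F C) (l : List Bool) (x : Dat) (s : Store)
    (hs : ∀ r > d + 1, s r = []) (hd : s d = l) (hx : s (d + 1) = x.code) :
    Computes O (iterate d c) s (l.length + 1 + Fn.iterCost F C (l.count true) x)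
      (Function.update (Function.update s d []) (d + 1) (F^[l.count true] x).code) := by
  induction l generalizing x s with
  | nil =>
    refine (computes_loop_nil hd).congr ?_ (by simp)
    rw [List.count_nil, Function.iterate_zero, id, ← hd, ← hx, Function.update_eq_self,
      Function.update_eq_self]
  | cons b l ih =>
    match b with
    | false =>
      refine (Reaches.loopCons hd ((computes_skip _).seq (ih x _ ?_ ?_ ?_))).congr ?_ ?_
      all_goals grind [Function.update_apply]
    | true =>
      refine (Reaches.loopCons hd ((hc _ x ?_ ?_).seq (ih (F x) _ ?_ ?_ ?_))).congr ?_ ?_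
      all_goals
        grind [Function.update_apply, List.count_cons_self, Fn.iterCost,
          Function.iterate_succ_apply]

theorem Implements.iter (hc : Implements O c (d + 1) F C) :
    Implements O (Cmd.onCons d (Cmd.seq (split d) (Cmd.seq (iterate d c)
      (mv₂ (d + 1) d (d + 2))))) d
      (fun v => match v with
        | .nil => .nil
        | .cons n x => F^[n.size] x)
      fun v => 30 * (v.size + 1) + match v with
        | .nil => 0
        | .cons n x => 30 * Fn.iterCost F C n.size x := by
  refine (Implements.onCons (C := fun v => 30 * v.size + 28 + match v with
    | .nil => 0
    | .cons n x => 30 * Fn.iterCost F C n.size x) rfl fun s n x hs hnx => ?_).mono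
    fun v => by omega
  have := Fn.size_iterate_le_iterCost F C n.size x
  refine ((computes_split hs hnx).seq <| (computes_iterate hc n.code x _ ?_ ?_ ?_).seq
    (computes_mv₂ ?_ ?_ ?_ ?_)).congr ?_ ?_
  all_goals grind [Function.update_apply, Dat.length_code, Dat.count_code, Dat.size]

open Classical in
theorem implements_query (d : ℕ) :
    Implements O (query d fun b => bif b then setTrue d else setNil d) d
      (fun v => if v.code ∈ O then .cons .nil .nil else .nil) fun v => 30 * (v.size + 1) := by
  intro s v hs hv
  by_cases h : v.code ∈ O
  · have := implements_setTrue (O := O) d s v hs hv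
    simp only [if_pos h]
    exact Reaches.mono (Reaches.query (b := true) (by simpa [hv] using h) this) (by grind)
  · have := implements_setNil (O := O) d s v hs hv
    simp only [if_neg h]
    exact Reaches.mono (Reaches.query (b := false) (by simpa [hv] using h) this) (by grind)

end Cmd

namespace Fn

/-- The stack program for a tree program, with argument and result in register `d`. -/
def toCmd : Fn → ℕ → Cmd
  | id, _ => .skip
  | nil, d => .setNil d
  | pair f g, d => .pair d (f.toCmd (d + 2)) (g.toCmd (d + 1))
  | hd, d => .onCons d (.readTree d (d + 1) (d + 2))
  | tl, d => .onCons d (.dropTree d (d + 1) (d + 2))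
  | comp g f, d => .seq (f.toCmd d) (g.toCmd d)
  | branch f g, d => .branch d (f.toCmd d) (g.toCmd d)
  | iter f, d =>
    .onCons d (.seq (.split d) (.seq (.iterate d (f.toCmd (d + 1))) (.mv₂ (d + 1) d (d + 2))))
  | query, d => .query d fun b => bif b then .setTrue d else .setNil d

theorem implements_toCmd (O : Language Bool) (f : Fn) (d : ℕ) :
    Cmd.Implements O (f.toCmd d) d (f.eval O) (f.cost O) := by
  induction f generalizing d with
  | id =>
    intro s v _ hv
    exact (Cmd.computes_skip s).congr (by rw [eval, ← hv, Function.update_eq_self]) (Nat.zero_le _)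
  | nil => exact Cmd.implements_setNil d
  | pair f g ihf ihg => exact (ihf _).pair (ihg _)
  | hd => exact Cmd.implements_hd d
  | tl => exact Cmd.implements_tl d
  | comp g f ihg ihf => exact (ihf d).seq (ihg d)
  | branch f g ihf ihg => exact (ihf d).branch (ihg d)
  | iter f ih => exact (ih (d + 1)).iter
  | query => exact Cmd.implements_query d

end Fn

/-! ### Data represented by trees -/

/-- Types whose elements are represented by trees. -/
class Enc (α : Type) where
  /-- The tree that represents an element. -/
  enc : α → Dat

open Enc (enc)

instance : Enc Dat := ⟨fun t => t⟩

instance : Enc Bool := ⟨fun b => bif b then .cons .nil .nil else .nil⟩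

instance {α β : Type} [Enc α] [Enc β] : Enc (α × β) := ⟨fun p => .cons (enc p.1) (enc p.2)⟩

instance {α : Type} [Enc α] : Enc (List α) := ⟨fun l => l.foldr (fun a t => .cons (enc a) t) .nil⟩

/-- Natural numbers are represented in unary. -/
instance : Enc ℕ := ⟨fun n => (Dat.cons .nil)^[n] .nil⟩

/-- The size of the representation. -/
def sz {α : Type} [Enc α] (a : α) : ℕ := (enc a).size

section

variable {α β : Type} [Enc α] [Enc β]

@[simp] theorem enc_dat (t : Dat) : enc t = t := rfl
@[simp] theorem enc_true : enc true = .cons .nil .nil := rfl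
@[simp] theorem enc_false : enc false = .nil := rfl
@[simp] theorem enc_pair (a : α) (b : β) : enc (a, b) = .cons (enc a) (enc b) := rfl
@[simp] theorem enc_nil : enc ([] : List α) = .nil := rfl
@[simp] theorem enc_cons (a : α) (l : List α) : enc (a :: l) = .cons (enc a) (enc l) := rfl
@[simp] theorem enc_zero : enc 0 = .nil := rfl
@[simp] theorem enc_succ (n : ℕ) : enc (n + 1) = .cons .nil (enc n) :=
  Function.iterate_succ_apply' _ _ _

@[simp] theorem sz_dat (t : Dat) : sz t = t.size := rfl
@[simp] theorem sz_true : sz true = 1 := rfl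
@[simp] theorem sz_false : sz false = 0 := rfl
@[simp] theorem sz_pair (a : α) (b : β) : sz (a, b) = sz a + sz b + 1 := rfl
@[simp] theorem sz_nil : sz ([] : List α) = 0 := rfl
@[simp] theorem sz_cons (a : α) (l : List α) : sz (a :: l) = sz a + sz l + 1 := rfl

@[simp] theorem sz_nat (n : ℕ) : sz n = n := by
  induction n with
  | zero => rfl
  | succ n ih => simpa [sz, Dat.size] using ih


theorem sz_bool_le (b : Bool) : sz b ≤ 1 := by cases b <;> simp

theorem length_le_sz (l : List α) : l.length ≤ sz l := by
  induction l with
  | nil => simp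
  | cons a l ih => simp; omega

end

/-! ### Polynomial and exponential bounds -/

section

variable {α β : Type} [Enc α] [Enc β] {u v : α → ℕ}

/-- `u` is bounded by a polynomial in the size of its argument. -/
def PolyBound (u : α → ℕ) : Prop := ∃ k, ∀ a, u a ≤ (sz a + 2) ^ k

/-- `u` is bounded by `2^{O(n)}`, where `n` is the size of its argument. -/
def ExpBound (u : α → ℕ) : Prop := ∃ c, ∀ a, u a ≤ c * 2 ^ (c * sz a)

namespace PolyBound

theorem mono (h : PolyBound u) (hv : ∀ a, v a ≤ u a) : PolyBound v := by
  obtain ⟨k, hk⟩ := h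
  exact ⟨k, fun a => (hv a).trans (hk a)⟩

theorem const (c : ℕ) : PolyBound fun _ : α => c := by
  refine ⟨c, fun a => c.lt_two_pow_self.le.trans ?_⟩
  gcongr
  omega

theorem size : PolyBound fun a : α => sz a := ⟨1, fun a => by simp⟩

theorem mul (h : PolyBound u) (h' : PolyBound v) : PolyBound fun a => u a * v a := by
  obtain ⟨k, hk⟩ := h
  obtain ⟨l, hl⟩ := h'
  exact ⟨k + l, fun a => (Nat.mul_le_mul (hk a) (hl a)).trans (pow_add _ k l).ge⟩

theorem add (h : PolyBound u) (h' : PolyBound v) : PolyBound fun a => u a + v a := by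
  obtain ⟨k, hk⟩ := h
  obtain ⟨l, hl⟩ := h'
  refine ⟨max k l + 1, fun a => ?_⟩
  calc u a + v a ≤ (sz a + 2) ^ max k l + (sz a + 2) ^ max k l := by
        refine add_le_add ((hk a).trans ?_) ((hl a).trans ?_) <;> gcongr <;> simp
    _ = 2 * (sz a + 2) ^ max k l := (two_mul _).symm
    _ ≤ (sz a + 2) ^ (max k l + 1) := by
        rw [pow_succ']
        gcongr
        omega

theorem pow (h : PolyBound u) (k : ℕ) : PolyBound fun a => u a ^ k := by
  obtain ⟨l, hl⟩ := h
  exact ⟨l * k, fun a => (Nat.pow_le_pow_left (hl a) k).trans (pow_mul _ l k).ge⟩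

theorem comp {u : β → ℕ} (h : PolyBound u) {f : α → β} (hf : PolyBound fun a => sz (f a)) :
    PolyBound fun a => u (f a) := by
  obtain ⟨k, hk⟩ := h
  exact ((hf.add (const 2)).pow k).mono fun a => hk (f a)

end PolyBound

namespace ExpBound

theorem mono (h : ExpBound u) (hv : ∀ a, v a ≤ u a) : ExpBound v := by
  obtain ⟨c, hc⟩ := h
  exact ⟨c, fun a => (hv a).trans (hc a)⟩

theorem add (h : ExpBound u) (h' : ExpBound v) : ExpBound fun a => u a + v a := by
  obtain ⟨c, hc⟩ := h
  obtain ⟨d, hd⟩ := h'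
  refine ⟨c + d, fun a => (Nat.add_le_add (hc a) (hd a)).trans ?_⟩
  rw [add_mul c d (2 ^ _)]
  gcongr <;> omega

theorem mul (h : ExpBound u) (h' : ExpBound v) : ExpBound fun a => u a * v a := by
  obtain ⟨c, hc⟩ := h
  obtain ⟨d, hd⟩ := h'
  refine ⟨c * d + (c + d), fun a => (Nat.mul_le_mul (hc a) (hd a)).trans ?_⟩
  calc c * 2 ^ (c * sz a) * (d * 2 ^ (d * sz a)) = c * d * 2 ^ ((c + d) * sz a) := by ring
    _ ≤ _ := Nat.mul_le_mul (Nat.le_add_right _ _)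
      (Nat.pow_le_pow_right (by norm_num) (Nat.mul_le_mul_right _ (Nat.le_add_left _ _)))

theorem pow (h : ExpBound u) (k : ℕ) : ExpBound fun a => u a ^ k := by
  induction k with
  | zero => exact ⟨1, fun a => by simpa using Nat.one_le_two_pow⟩
  | succ k ih => simpa only [pow_succ] using ih.mul h

end ExpBound

theorem PolyBound.expBound (h : PolyBound u) : ExpBound u := by
  obtain ⟨k, hk⟩ := h
  have hsize : ExpBound fun a : α => sz a + 2 := ⟨2, fun a => by
    have := (sz a).lt_two_pow_self
    rw [mul_comm 2 (sz a), pow_mul]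
    nlinarith⟩
  exact (hsize.pow k).mono hk

end

/-! ### Functions computed in polynomial or exponential time -/

section

variable (O : Language Bool) {α β : Type} [Enc α] [Enc β] (f : α → β)

/-- `f` is computed by a tree program of polynomial cost. -/
def PT : Prop :=
  ∃ t : Fn, (∀ a, t.eval O (enc a) = enc (f a)) ∧ PolyBound fun a : α => t.cost O (enc a)

/-- `f` is computed by a tree program of exponential cost. -/
def ET : Prop :=
  ∃ t : Fn, (∀ a, t.eval O (enc a) = enc (f a)) ∧ ExpBound fun a : α => t.cost O (enc a)

end

/-! ### Verifiers for languages in NE -/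

namespace Cmd

variable {O : Language Bool} {i j : ℕ}

/-- Moves the contents of `i` to `j`, replacing every bit by a guessed one. -/
def guessLoop (i j : ℕ) : Cmd := loop i fun _ => guess (push j)

theorem reaches_guessLoop (hij : i ≠ j) (s : Store) :
    Reaches O (guessLoop i j) s (3 * (s i).length + 1)
      {s' | ∃ w : List Bool, w.length = (s i).length ∧
        s' = Function.update (Function.update s i []) j (w ++ s j)} := by
  generalize hl : s i = l
  induction l generalizing s with
  | nil =>
    have hS : {s' | ∃ w : List Bool, w.length = ([] : List Bool).length ∧
        s' = Function.update (Function.update s i []) j (w ++ s j)} = {s} := by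
      have hs : Function.update (Function.update s i []) j (s j) = s := by
        grind [Function.update_apply]
      ext s'
      simp [hs]
    exact hS ▸ computes_loop_nil hl
  | cons b l ih =>
    have hguess := Reaches.guess fun b => computes_push (O := O) j b (Function.update s i l)
    have hloop : Reaches O (guessLoop i j) s _ _ := Reaches.loopCons hl <|
      hguess.biUnion_seq fun s₁ hs₁ => ih s₁ <| by
        obtain ⟨b', rfl⟩ := Set.mem_iUnion.mp hs₁
        simp [hij]
    have hS : {s' | ∃ w : List Bool, w.length = (b :: l).length ∧
        s' = Function.update (Function.update s i []) j (w ++ s j)} =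
        ⋃ s₁ ∈ ⋃ b, {Function.update (Function.update s i l) j (b :: Function.update s i l j)},
          {s' | ∃ w : List Bool, w.length = l.length ∧
            s' = Function.update (Function.update s₁ i []) j (w ++ s₁ j)} := by
      ext s'
      simp only [Set.mem_iUnion, Set.mem_ofPred_eq, Set.mem_singleton_iff, exists_prop]
      constructor
      · rintro ⟨w, hw, rfl⟩
        obtain ⟨w, b', rfl⟩ := List.eq_nil_or_concat w |>.resolve_left (by grind)
        exact ⟨_, ⟨b', rfl⟩, w, by simpa using hw, by grind [Function.update_apply]⟩
      · rintro ⟨_, ⟨b', rfl⟩, w, hw, rfl⟩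
        exact ⟨w ++ [b'], by simp [hw], by grind [Function.update_apply]⟩
    exact hS ▸ hloop.mono (by grind)

/-- Computes the tree `b` by `B` from the input, and copies `b` to register `1`. -/
def prepare (B : Fn) : Cmd := seq (readTree 0 1 2) (seq (B.toCmd 0) (dup 0 1 2))

/-- Runs `V` on the pair of the tree in register `0` and the first tree in register `2`. -/
def conclude (V : Fn) : Cmd :=
  seq (readTree 2 3 4) <| seq (mv₂ 2 1 3) <| seq (mv₂ 0 1 2) <| seq (push 1 true) (V.toCmd 1)

/-- Computes a tree `b` from the input by `B`, guesses as many bits as the code of `b` has, and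
runs `V` on the pair of `b` and the tree coded by these bits. -/
def verifier (B V : Fn) : Cmd := seq (prepare B) (seq (guessLoop 1 2) (conclude V))

theorem input_apply (x : List Bool) (r : ℕ) : input x r = if r = 0 then x else [] :=
  Function.update_apply ..

theorem computes_prepare (B : Fn) (x : List Bool) :
    Computes O (prepare B) (input x) (15 * x.length + 18 + 11 * B.cost O (.ofCode x))
      (Function.update (input (B.eval O (.ofCode x)).code) 1 (B.eval O (.ofCode x)).code) := by
  have := B.size_eval_le_cost O (.ofCode x)
  refine ((computes_readTree ?_ ?_ ?_ ?_ ?_).seq <| (B.implements_toCmd O 0 _ (.ofCode x) ?_ ?_).seq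
    (computes_dup ?_ ?_ ?_ ?_ ?_)).congr ?_ ?_
  all_goals grind [Function.update_apply, Dat.length_code, input_apply]

theorem computes_conclude (V : Fn) (b : Dat) (w : List Bool) (hw : w.length = b.code.length) :
    Computes O (conclude V) (Function.update (input b.code) 2 w)
      (72 * b.size + 50 + V.cost O (.cons b (.ofCode w)))
      (Function.update (fun _ => []) 1 (V.eval O (.cons b (.ofCode w))).code) := by
  have := Dat.size_ofCode_le w
  refine ((computes_readTree ?_ ?_ ?_ ?_ ?_).seq <| (computes_mv₂ ?_ ?_ ?_ ?_).seq <|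
    (computes_mv₂ ?_ ?_ ?_ ?_).seq <| (computes_push 1 true _).seq
    (V.implements_toCmd O 1 _ (.cons b (.ofCode w)) ?_ ?_)).congr (funext fun r => ?_) ?_
  case refine_15 => simp [input_apply, Dat.code]
  case refine_17 =>
    simp [input_apply, Dat.length_code] at hw ⊢
    omega
  case refine_16 =>
    simp only [Function.update_apply, input_apply]
    grind
  all_goals grind [Function.update_apply, input_apply]

theorem reaches_verifier (B V : Fn) (x : List Bool) {b : Dat} (hb : B.eval O (.ofCode x) = b)
    {D : ℕ} (hD : ∀ t : Dat, t.size ≤ 2 * b.size + 1 → V.cost O (.cons b t) ≤ D) :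
    Reaches O (verifier B V) (input x) (15 * x.length + 90 * (B.cost O (.ofCode x) + 1) + D)
      {s | ∃ w : List Bool, w.length = b.code.length ∧
        s = Function.update (fun _ => []) 1 (V.eval O (.cons b (.ofCode w))).code} := by
  have hprepare := computes_prepare (O := O) B x
  have hsize := B.size_eval_le_cost O (.ofCode x)
  rw [hb] at hprepare hsize
  have hguess := reaches_guessLoop (O := O) (i := 1) (j := 2) (by norm_num)
    (Function.update (input b.code) 1 b.code)
  have hS : ∀ w, Function.update (Function.update (Function.update (input b.code) 1 b.code) 1 []) 2
      (w ++ Function.update (input b.code) 1 b.code 2) = Function.update (input b.code) 2 w := by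
    grind [Function.update_apply, input_apply]
  simp only [hS, Function.update_self] at hguess
  have hconclude : ∀ s ∈ {s | ∃ w : List Bool, w.length = b.code.length ∧
        s = Function.update (input b.code) 2 w},
      Computes O (conclude V) s (72 * b.size + 50 + D)
        (Function.update (fun _ => []) 1 (V.eval O (.cons b (.ofCode (s 2)))).code) := by
    rintro _ ⟨w, hw, rfl⟩
    rw [Function.update_self]
    refine (computes_conclude V b w hw).mono ?_
    gcongr
    exact hD _ ((Dat.size_ofCode_le w).trans (hw.trans b.length_code).le)
  refine (congrArg (Reaches O _ _ _) (Set.ext fun s => ?_)).mp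
    ((hprepare.seq (hguess.biUnion_seq hconclude)).mono ?_)
  · simp only [Set.mem_ofPred_eq, Set.mem_iUnion, Set.mem_singleton_iff, exists_prop]
    constructor
    · rintro ⟨_, ⟨w, hw, rfl⟩, rfl⟩
      exact ⟨w, hw, by rw [Function.update_self]⟩
    · rintro ⟨w, hw, rfl⟩
      exact ⟨_, ⟨w, hw, rfl⟩, by rw [Function.update_self]⟩
  · rw [Dat.length_code]
    omega

end Cmd

theorem Dat.exists_ofCode_eq_of_size_le {t b : Dat} (h : t.size ≤ b.size) :
    ∃ w : List Bool, w.length = b.code.length ∧ ofCode w = t := by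
  refine ⟨t.code ++ List.replicate (2 * (b.size - t.size)) false, ?_, ofCode_code_append t _⟩
  simp only [List.length_append, length_code, List.length_replicate]
  omega

section

variable {O : Language Bool} {α β : Type} [Enc α] [Enc β]

theorem headD_code_enc (b : Bool) : (enc b).code.headD false = b := by
  cases b <;> rfl

theorem ET.expBound_sz {f : α → β} (hf : ET O f) : ExpBound fun a => sz (f a) := by
  obtain ⟨t, ht, hb⟩ := hf
  exact hb.mono fun a => (congrArg Dat.size (ht a)).ge.trans (t.size_eval_le_cost O _)

/-- The certificates are bounded by the size of `r x`, so that `r` also serves as padding. -/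
theorem mem_NE_of_verifier {r : Dat → β} {V : β × Dat → Bool} (hr : ET ⊥ r) (hV : PT ⊥ V)
    {L : Language Bool} (hsound : ∀ x t, V (r (.ofCode x), t) = true → x ∈ L)
    (hcomplete : ∀ x ∈ L, ∃ t : Dat, t.size ≤ sz (r (.ofCode x)) ∧ V (r (.ofCode x), t) = true) :
    L ∈ NE := by
  have hsz := hr.expBound_sz
  obtain ⟨B, hB, hBcost⟩ := hr
  obtain ⟨V', hV', k, hk⟩ := hV
  have hone : ExpBound fun _ : Dat => 1 := (PolyBound.const 1).expBound
  obtain ⟨c, hc⟩ : ExpBound fun z => 90 * (B.cost ⊥ z + 1) + (3 * sz (r z) + 4) ^ k :=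
    ((PolyBound.const 90).expBound.mul (hBcost.add hone)).add
      ((((PolyBound.const 3).expBound.mul hsz).add (PolyBound.const 4).expBound).pow k)
  have hreach (x : List Bool) := Cmd.reaches_verifier B V' x (hB (.ofCode x))
    (D := (3 * sz (r (.ofCode x)) + 4) ^ k) fun t ht => (hk (r (.ofCode x), t)).trans
      (Nat.pow_le_pow_left (by simp only [sz_pair, sz_dat]; unfold sz; omega) k)
  refine Cmd.mem_NE_of_reaches (t := c + 15) (fun x => (hreach x).mono ?_) fun x => ?_
  · have hx := Dat.size_ofCode_le x
    calc _ ≤ 15 * 2 ^ x.length + c * 2 ^ (c * sz (Dat.ofCode x)) := by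
          rw [add_assoc]
          exact add_le_add (Nat.mul_le_mul_left _ x.length.lt_two_pow_self.le) (hc _)
      _ ≤ 15 * 2 ^ ((c + 15) * x.length) + c * 2 ^ ((c + 15) * x.length) := by
          gcongr
          · norm_num
          · exact Nat.le_mul_of_pos_left _ (by omega)
          · norm_num
          · omega
          · exact hx
      _ = _ := by ring
  · have hverifies (t : Dat) :
        (V'.eval ⊥ (.cons (enc (r (.ofCode x))) t)).code.headD false = V (r (.ofCode x), t) :=
      (congrArg (fun y : Dat => y.code.headD false) (hV' (r (.ofCode x), t))).trans
        (headD_code_enc _)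
    constructor
    · intro hxL
      obtain ⟨t, ht, hVt⟩ := hcomplete x hxL
      obtain ⟨w, hw, rfl⟩ := Dat.exists_ofCode_eq_of_size_le ht
      exact ⟨_, ⟨w, hw, rfl⟩, (hverifies _).trans hVt⟩
    · rintro ⟨_, ⟨w, -, rfl⟩, hw⟩
      exact hsound x _ ((hverifies _).symm.trans hw)

end

/-! ### Generators in FP with an oracle -/

namespace Cmd

variable {O : Language Bool} {i j : ℕ}

/-- Replaces the contents of `i` by the code of its length, moved to `j`. -/
def readUnary (i j : ℕ) : Cmd :=
  seq (push j false) (loop i fun _ => seq (push j false) (push j true))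

/-- Decodes one bit from `i` to `j`. -/
def decodeBit (i j : ℕ) : Cmd :=
  pop i skip fun b => bif b then pop i skip fun _ => pop i skip fun _ => push j true
    else push j false

/-- Decodes a list of bits from `i` to `j`, in reverse order. -/
def decodeBits (i j : ℕ) : Cmd := loop i fun b => bif b then decodeBit i j else skip

theorem computes_unaryLoop (hij : i ≠ j) (s : Store) (n : ℕ) (hj : s j = (enc n).code) :
    Computes O (loop i fun _ => seq (push j false) (push j true)) s (3 * (s i).length + 1)
      (Function.update (Function.update s i []) j (enc ((s i).length + n)).code) := by
  generalize hl : s i = l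
  induction l generalizing s n with
  | nil => exact (computes_loop_nil hl).congr (by grind [Function.update_apply]) (by simp)
  | cons b l ih =>
    refine (Reaches.loopCons hl (((computes_push ..).seq (computes_push ..)).seq
      (ih _ (n + 1) ?_ ?_))).congr ?_ ?_
    all_goals grind [Function.update_apply, Dat.code, enc_succ]

theorem computes_readUnary (hij : i ≠ j) (s : Store) (hj : s j = []) :
    Computes O (readUnary i j) s (3 * (s i).length + 2)
      (Function.update (Function.update s i []) j (enc (s i).length).code) := by
  refine ((computes_push ..).seq (computes_unaryLoop hij _ 0 ?_)).congr ?_ ?_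
  all_goals grind [Function.update_apply, Dat.code, enc_zero]

theorem computes_decodeBit (hij : i ≠ j) (s : Store) (b : Bool) (x : List Bool)
    (hi : s i = (enc b).code ++ x) :
    Computes O (decodeBit i j) s 4 (Function.update (Function.update s i x) j (b :: s j)) := by
  cases b with
  | false =>
    have hi : s i = false :: x := hi
    have hpop : Computes O (decodeBit i j) s _ _ := Reaches.popCons hi (computes_push j false _)
    exact hpop.congr (by grind [Function.update_apply]) (by norm_num)
  | true =>
    have hpop (s' : Store) (hs' : s' i = false :: x) := Reaches.popCons (c' := skip)
      (c := fun _ => push j true) hs' (computes_push (O := O) j true _)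
    have hpop' (s' : Store) (hs' : s' i = false :: false :: x) := Reaches.popCons (c' := skip)
      (c := fun _ => pop i skip fun _ => push j true) hs' (hpop _ (by simp))
    have hi : s i = true :: false :: false :: x := hi
    have hpop'' : Computes O (decodeBit i j) s _ _ := Reaches.popCons hi (hpop' _ (by simp))
    exact hpop''.congr (by grind [Function.update_apply]) le_rfl

theorem computes_decodeBits (hij : i ≠ j) (w : List Bool) (s : Store) (hi : s i = (enc w).code) :
    Computes O (decodeBits i j) s (5 * w.length + 2)
      (Function.update (Function.update s i []) j (w.reverse ++ s j)) := by
  induction w generalizing s with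
  | nil =>
    refine (Reaches.loopCons hi ((computes_skip _).seq (computes_loop_nil ?_))).congr ?_ ?_
    all_goals grind [Function.update_apply]
  | cons b w ih =>
    have hi : s i = true :: ((enc b).code ++ (enc w).code) := hi
    refine (Reaches.loopCons hi ((computes_decodeBit hij _ b _ (Function.update_self ..)).seq
      (ih _ ?_))).congr ?_ ?_
    all_goals grind [Function.update_apply]

/-- Applies the tree program `W` to the length of the input, and decodes the result. -/
def generator (W : Fn) : Cmd :=
  seq (readUnary 0 1) (seq (W.toCmd 1) (seq (decodeBits 1 2) (mv 2 0)))

theorem computes_generator (W : Fn) (x w : List Bool) (hw : W.eval O (enc x.length) = enc w) :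
    Computes O (generator W) (input x) (3 * x.length + 8 * W.cost O (enc x.length) + 5)
      (input w) := by
  have := W.size_eval_le_cost O (enc x.length)
  have : w.length ≤ (enc w).size := length_le_sz w
  refine ((computes_readUnary ?_ _ ?_).seq <| (W.implements_toCmd O 1 _ (enc x.length) ?_ ?_).seq <|
    (computes_decodeBits ?_ w _ ?_).seq (computes_mv ?_ _)).congr (funext fun r => ?_) ?_
  all_goals grind [Function.update_apply, input_apply]

end Cmd

theorem PT.mem_FPWith {O : Language Bool} {w : ℕ → List Bool} (hw : PT O w) :
    (fun x => w x.length) ∈ FPWith O := by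
  obtain ⟨W, hW, k, hk⟩ := hw
  refine Cmd.mem_FPWith_of_computes (c := Cmd.generator W)
    (3 * .X + 8 * (.X + 2) ^ k + 5)
    (fun x => (Cmd.computes_generator W x _ (hW x.length)).mono ?_) fun x => Function.update_self ..
  have := hk x.length
  simp only [sz_nat] at this
  simp only [Polynomial.eval_add, Polynomial.eval_mul, Polynomial.eval_pow, Polynomial.eval_X,
    Polynomial.eval_ofNat]
  gcongr

attribute [fun_prop] PT

namespace PT

variable {O : Language Bool} {α β γ δ : Type} [Enc α] [Enc β] [Enc γ] [Enc δ]

theorem polyBound {f : α → β} (h : PT O f) : PolyBound fun a => sz (f a) := by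
  obtain ⟨t, ht, hp⟩ := h
  refine hp.mono fun a => ?_
  rw [sz, ← ht]
  exact t.size_eval_le_cost O _

theorem congr_enc {f : α → β} (h : PT O f) {g : α → γ} (hg : ∀ a, enc (g a) = enc (f a)) :
    PT O g := by
  obtain ⟨t, ht, hp⟩ := h
  exact ⟨t, fun a => by rw [ht, hg], hp⟩

theorem of_eq {f g : α → β} (h : PT O f) (hg : ∀ a, g a = f a) : PT O g :=
  h.congr_enc fun a => by rw [hg]

@[fun_prop]
protected theorem id : PT O fun a : α => a :=
  ⟨.id, fun _ => rfl, PolyBound.size⟩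

@[fun_prop]
theorem comp {g : β → γ} {f : α → β} (hg : PT O g) (hf : PT O f) : PT O fun a => g (f a) := by
  have hs := hf.polyBound
  obtain ⟨t, ht, hp⟩ := hf
  obtain ⟨u, hu, hq⟩ := hg
  refine ⟨.comp u t, fun a => by simp [Fn.eval, ht, hu], ?_⟩
  refine (hp.add (hq.comp hs)).mono fun a => ?_
  simp [Fn.cost, ht]

@[fun_prop]
theorem pair {f : α → β} {g : α → γ} (hf : PT O f) (hg : PT O g) : PT O fun a => (f a, g a) := by
  have hs := hf.polyBound
  have hs' := hg.polyBound
  obtain ⟨t, ht, hp⟩ := hf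
  obtain ⟨u, hu, hq⟩ := hg
  refine ⟨.pair t u, fun a => by simp [Fn.eval, ht, hu], ?_⟩
  refine ((hp.add hq).add ((PolyBound.const 30).mul
    (((PolyBound.size.add hs).add hs').add (.const 1)))).mono fun a => ?_
  simp [Fn.cost, ht, hu, sz]

@[fun_prop]
theorem fst {f : α → β × γ} (hf : PT O f) : PT O fun a => (f a).1 := by
  refine comp (g := fun p : β × γ => p.1) ⟨.hd, fun _ => rfl, ?_⟩ hf
  exact ((PolyBound.const 30).mul (PolyBound.size.add (.const 1))).mono fun a => le_rfl

@[fun_prop]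
theorem snd {f : α → β × γ} (hf : PT O f) : PT O fun a => (f a).2 := by
  refine comp (g := fun p : β × γ => p.2) ⟨.tl, fun _ => rfl, ?_⟩ hf
  exact ((PolyBound.const 30).mul (PolyBound.size.add (.const 1))).mono fun a => le_rfl

@[fun_prop]
theorem hd {f : α → Dat} (hf : PT O f) : PT O fun a => (f a).hd := by
  refine comp (g := fun p : Dat => p.hd) ⟨.hd, fun _ => rfl, ?_⟩ hf
  exact ((PolyBound.const 30).mul (PolyBound.size.add (.const 1))).mono fun a => le_rfl

@[fun_prop]
theorem tl {f : α → Dat} (hf : PT O f) : PT O fun a => (f a).tl := by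
  refine comp (g := fun p : Dat => p.tl) ⟨.tl, fun _ => rfl, ?_⟩ hf
  exact ((PolyBound.const 30).mul (PolyBound.size.add (.const 1))).mono fun a => le_rfl

theorem const_dat (t : Dat) : PT O fun _ : α => t := by
  induction t with
  | nil =>
    refine ⟨.nil, fun _ => rfl, ?_⟩
    exact ((PolyBound.const 4).mul (PolyBound.size.add (.const 1))).mono fun a => le_rfl
  | cons a b iha ihb => exact (pair iha ihb).congr_enc fun _ => rfl

@[fun_prop]
theorem const (b : β) : PT O fun _ : α => b :=
  (const_dat (enc b)).congr_enc fun _ => rfl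

theorem encode {f : α → β} (hf : PT O f) : PT O fun a => enc (f a) :=
  hf.congr_enc fun _ => rfl

open Classical in
theorem query {f : α → β} (hf : PT O f) : PT O fun a => decide ((enc (f a)).code ∈ O) := by
  refine comp (g := fun b : β => decide ((enc b).code ∈ O)) ⟨.query, fun b => ?_, ?_⟩ hf
  · by_cases h : (enc b).code ∈ O <;> simp [Fn.eval, h]
  · exact ((PolyBound.const 30).mul (PolyBound.size.add (.const 1))).mono fun a => le_rfl

theorem branch {e : α → Dat} {f g h : α → β} (he : PT O e) (hf : PT O f) (hg : PT O g)
    (h₀ : ∀ a, e a = .nil → h a = f a) (h₁ : ∀ a, e a ≠ .nil → h a = g a) : PT O h := by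
  have hs := he.polyBound
  obtain ⟨t, ht, hp⟩ := he
  obtain ⟨u, hu, hq⟩ := hf
  obtain ⟨v, hv, hr⟩ := hg
  refine ⟨.comp (.branch u v) (.pair t .id), fun a => ?_, ?_⟩
  · cases hea : e a with
    | nil => simp [Fn.eval, ht, hea, hu, h₀]
    | cons x y => simp [Fn.eval, ht, hea, hv, h₁]
  · refine (((hp.add hq).add hr).add ((PolyBound.const 100).mul
      ((PolyBound.size.add hs).add (.const 1)))).mono fun a => ?_
    cases hea : e a <;> simp [Fn.cost, Fn.eval, ht, hea, Dat.size, sz] <;> omega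

@[fun_prop]
theorem cond {c : α → Bool} {f g : α → β} (hc : PT O c) (hf : PT O f) (hg : PT O g) :
    PT O fun a => bif c a then f a else g a :=
  branch hc.encode hg hf (fun a h => by cases hca : c a <;> simp [hca] at h ⊢)
    fun a h => by cases hca : c a <;> simp [hca] at h ⊢

@[fun_prop]
theorem ite {c : α → Prop} [DecidablePred c] {f g : α → β} (hc : PT O fun a => decide (c a))
    (hf : PT O f) (hg : PT O g) : PT O fun a => if c a then f a else g a :=
  (cond hc hf hg).of_eq fun _ => (Bool.cond_decide _ _ _).symm

theorem listCases {l : α → List β} {f : α → γ} {g : α → β → List β → γ} {h : α → γ}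
    (hl : PT O l) (hf : PT O f) (hg : PT O fun p : α × β × List β => g p.1 p.2.1 p.2.2)
    (h₀ : ∀ a, l a = [] → h a = f a) (h₁ : ∀ a b t, l a = b :: t → h a = g a b t) : PT O h := by
  have hs := hl.polyBound
  obtain ⟨t, ht, hp⟩ := hl
  obtain ⟨u, hu, hq⟩ := hf
  obtain ⟨v, hv, k, hr⟩ := hg
  refine ⟨.comp (.branch (.comp u .hd) v) (.pair t (.pair .id t)), fun a => ?_, ?_⟩
  · cases hla : l a with
    | nil => simp [Fn.eval, ht, hla, hu, h₀, Dat.hd]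
    | cons b m =>
      have := hv (a, b, m)
      simp only [enc_pair] at this
      simp [Fn.eval, ht, hla, h₁ a b m hla, this]
  · refine (((hp.add hp).add hq).add (((PolyBound.const 300).mul
      ((PolyBound.size.add hs).add (.const 1))).add
        (((PolyBound.size.add hs).add (.const 4)).pow k))).mono fun a => ?_
    cases hla : l a with
    | nil =>
      simp [Fn.cost, Fn.eval, ht, hla, Dat.size, sz, Dat.hd]
      omega
    | cons b m =>
      have hcost : v.cost O (.cons (enc a) (.cons (enc b) (enc m))) ≤
          (sz a + (sz b + sz m + 1) + 1 + 2) ^ k := hr (a, b, m)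
      have hpow : (sz a + (sz b + sz m + 1) + 1 + 2) ^ k ≤ (sz a + (sz b + sz m + 1) + 4) ^ k :=
        Nat.pow_le_pow_left (by omega) k
      simp [Fn.cost, Fn.eval, ht, hla, Dat.size, sz] at *
      omega

end PT

/-! ### Iteration -/

section

variable {O : Language Bool} {γ : Type} [Enc γ] {t : Fn} {step : γ → γ}

theorem Fn.iterCost_le (f : Dat → Dat) (c : Dat → ℕ) (C S : ℕ) (n : ℕ) (x : Dat)
    (hc : ∀ i < n, c (f^[i] x) ≤ C) (hS : (f^[n] x).size ≤ S) : iterCost f c n x ≤ n * C + S := by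
  induction n generalizing x with
  | zero => simpa [iterCost] using hS
  | succ n ih =>
    have htail := ih (f x) (fun i hi => hc (i + 1) (by omega)) hS
    have hhead := hc 0 (by omega)
    simp only [iterCost, Function.iterate_zero, id_eq] at *
    rw [Nat.succ_mul]
    omega

theorem Fn.eval_iterate (ht : ∀ a, t.eval O (enc a) = enc (step a)) (n : ℕ) (a : γ) :
    (t.eval O)^[n] (enc a) = enc (step^[n] a) :=
  ((Function.Semiconj.iterate_right (fun b => (ht b).symm) n).eq a).symm

theorem Fn.cost_iter_le (ht : ∀ a, t.eval O (enc a) = enc (step a)) {k : ℕ}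
    (hk : ∀ a : γ, t.cost O (enc a) ≤ (sz a + 2) ^ k) (n : Dat) (a : γ) (B : ℕ)
    (hB : ∀ i ≤ n.size, sz (step^[i] a) ≤ B) :
    (Fn.iter t).cost O (.cons n (enc a)) ≤
      30 * (n.size + B + 2) + 30 * (n.size * (B + 2) ^ k + B) := by
  have hiter := Fn.iterCost_le (t.eval O) (t.cost O) ((B + 2) ^ k) B n.size (enc a)
    (fun i hi => by
      rw [Fn.eval_iterate ht]
      exact (hk _).trans (Nat.pow_le_pow_left (by have := hB i hi.le; omega) k))
    (by rw [Fn.eval_iterate ht]; exact hB _ le_rfl)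
  have hinit := hB 0 (Nat.zero_le _)
  simp only [Fn.cost, Dat.size, Function.iterate_zero, id_eq, sz] at *
  omega

theorem Fn.cost_iter_pair_le {α : Type} [Enc α] (ht : ∀ a, t.eval O (enc a) = enc (step a)) {k : ℕ}
    (hk : ∀ a : γ, t.cost O (enc a) ≤ (sz a + 2) ^ k) {p q : Fn} {x : α} {n : Dat} {a : γ}
    (hp : p.eval O (enc x) = n) (hq : q.eval O (enc x) = enc a) {B : ℕ}
    (hB : ∀ i ≤ n.size, sz (step^[i] a) ≤ B) :
    (Fn.comp (.iter t) (.pair p q)).cost O (enc x) ≤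
      p.cost O (enc x) + q.cost O (enc x) + 30 * (sz x + n.size + sz a + 1) +
        (30 * (n.size + B + 2) + 30 * (n.size * (B + 2) ^ k + B)) := by
  have hcost : (Fn.comp (.iter t) (.pair p q)).cost O (enc x) = p.cost O (enc x) +
      q.cost O (enc x) + 30 * (sz x + n.size + sz a + 1) +
        (Fn.iter t).cost O (.cons n (enc a)) := by
    simp only [Fn.cost, Fn.eval, hp, hq, sz]
  rw [hcost]
  exact Nat.add_le_add_left (Fn.cost_iter_le ht hk n a B hB) _

end

section

variable {α : Type} [Enc α]

@[simp] theorem sz_append (l m : List α) : sz (l ++ m) = sz l + sz m := by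
  induction l with
  | nil => simp
  | cons a l ih => simp [ih]; omega

@[simp] theorem sz_reverse (l : List α) : sz l.reverse = sz l := by
  induction l with
  | nil => simp
  | cons a l ih => simp [ih]; omega

theorem sz_le_of_prefix {l m : List α} (h : l <+: m) : sz l ≤ sz m := by
  obtain ⟨t, rfl⟩ := h
  simp

theorem sz_le_of_suffix {l m : List α} (h : l <:+ m) : sz l ≤ sz m := by
  obtain ⟨t, rfl⟩ := h
  simp

theorem sz_le_of_mem {l : List α} {a : α} (h : a ∈ l) : sz a < sz l := by
  obtain ⟨s, t, rfl⟩ := List.append_of_mem h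
  simp only [sz_append, sz_cons]
  omega

theorem sz_le_length_mul (l : List α) (c : ℕ) (h : ∀ a ∈ l, sz a ≤ c) :
    sz l ≤ l.length * (c + 1) := by
  induction l with
  | nil => simp
  | cons a l ih =>
    have ha := h a (by simp)
    have hl := ih fun b hb => h b (by simp [hb])
    simp only [sz_cons, List.length_cons, Nat.succ_mul]
    omega

theorem sz_bits_le (l : List Bool) : sz l ≤ 2 * l.length :=
  (sz_le_length_mul l 1 fun b _ => sz_bool_le b).trans (mul_comm _ _).le

end

namespace PT

variable {O : Language Bool} {α β γ : Type} [Enc α] [Enc β] [Enc γ]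

theorem iterateTree {e : α → Dat} {init : α → γ} {step : γ → γ} (he : PT O e) (hi : PT O init)
    (hs : PT O step) {B : α → ℕ} (hB : PolyBound B)
    (hb : ∀ a, ∀ i ≤ (e a).size, sz (step^[i] (init a)) ≤ B a) :
    PT O fun a => step^[(e a).size] (init a) := by
  have hes := he.polyBound
  have his := hi.polyBound
  obtain ⟨t, ht, hp⟩ := he
  obtain ⟨u, hu, hq⟩ := hi
  obtain ⟨v, hv, k, hr⟩ := hs
  refine ⟨.comp (.iter v) (.pair t u), fun a => ?_, ?_⟩
  · simp [Fn.eval, ht, hu, Fn.eval_iterate hv]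
  · refine (((hp.add hq).add ((PolyBound.const 30).mul (((PolyBound.size.add hes).add his).add
      (.const 1)))).add (((PolyBound.const 30).mul ((hes.add hB).add (.const 2))).add
      ((PolyBound.const 30).mul ((hes.mul ((hB.add (.const 2)).pow k)).add hB)))).mono fun a => ?_
    exact Fn.cost_iter_pair_le hv hr (ht a) (hu a) (hb a)

theorem iterate {n : α → ℕ} {init : α → γ} {step : α → γ → γ} (hn : PT O n) (hi : PT O init)
    (hs : PT O fun p : α × γ => step p.1 p.2) {B : α → ℕ} (hB : PolyBound B)
    (hb : ∀ a, ∀ i ≤ n a, sz ((step a)^[i] (init a)) ≤ B a) :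
    PT O fun a => (step a)^[n a] (init a) := by
  have hrun : ∀ a i, (fun p : α × γ => (p.1, step p.1 p.2))^[i] (a, init a) =
      (a, (step a)^[i] (init a)) := fun a i =>
    ((Function.Semiconj.iterate_right (f := Prod.mk a) (fun _ => rfl) i).eq (init a)).symm
  have hsize : ∀ m : ℕ, (enc m).size = m := sz_nat
  refine (iterateTree (init := fun a => (a, init a)) (step := fun p => (p.1, step p.1 p.2))
    hn.encode (by fun_prop) (by fun_prop) ((PolyBound.size.add hB).add (.const 1))
    fun a i h => ?_).snd.of_eq fun a => by rw [hrun, hsize]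
  have := hb a i (by rwa [hsize] at h)
  rw [hrun, sz_pair]
  omega

theorem foldl {l : α → List β} {init : α → γ} {step : α → γ → β → γ} (hl : PT O l)
    (hi : PT O init) (hs : PT O fun p : α × γ × β => step p.1 p.2.1 p.2.2) {B : α → ℕ}
    (hB : PolyBound B)
    (hb : ∀ a l', l' <+: l a → sz (l'.foldl (step a) (init a)) ≤ B a) :
    PT O fun a => (l a).foldl (step a) (init a) := by
  let st : α × List β × γ → α × List β × γ := fun p =>
    match p.2.1 with
    | [] => p
    | b :: t => (p.1, t, step p.1 p.2.2 b)
  have hst : PT O st :=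
    listCases (l := fun p => p.2.1) (g := fun p b t => (p.1, t, step p.1 p.2.2 b)) (by fun_prop)
      PT.id (by fun_prop) (fun p h => by simp only [st, h]) fun p b t h => by simp only [st, h]
  have hrun : ∀ a i, st^[i] (a, l a, init a) =
      (a, (l a).drop i, ((l a).take i).foldl (step a) (init a)) := by
    intro a i
    induction i with
    | zero => simp
    | succ i ih =>
      rw [Function.iterate_succ_apply', ih]
      by_cases h : i < (l a).length
      · rw [List.drop_eq_getElem_cons h, List.take_add_one, List.getElem?_eq_getElem h]
        simp only [st, Option.toList_some, List.foldl_append, List.foldl_cons, List.foldl_nil]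
      · have hi : (l a).length ≤ i := by omega
        have hi' : (l a).length ≤ i + 1 := by omega
        simp [st, List.drop_eq_nil_of_le, List.take_of_length_le, hi, hi']
  refine (iterateTree (init := fun a => (a, l a, init a)) (step := st) hl.encode (by fun_prop)
    hst (((PolyBound.size.add hl.polyBound).add hB).add (.const 2))
    fun a i _ => ?_).snd.snd.of_eq fun a => ?_
  · have hacc := hb a _ (List.take_prefix i (l a))
    have hrest := sz_le_of_suffix (List.drop_suffix i (l a))
    rw [hrun, sz_pair, sz_pair]
    omega
  · have hall := List.take_of_length_le (length_le_sz (l a))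
    rw [sz] at hall
    rw [hrun, hall]

end PT

namespace PT

variable {O : Language Bool} {α β γ : Type} [Enc α] [Enc β] [Enc γ]

/-! ### Booleans and numbers -/

section

variable {f g : α → Bool} {m n : α → ℕ}

@[fun_prop]
theorem and (hf : PT O f) (hg : PT O g) : PT O fun a => f a && g a :=
  (cond hf hg (const false)).of_eq fun a => by cases f a <;> rfl

@[fun_prop]
theorem or (hf : PT O f) (hg : PT O g) : PT O fun a => f a || g a :=
  (cond hf (const true) hg).of_eq fun a => by cases f a <;> rfl

@[fun_prop]
theorem not (hf : PT O f) : PT O fun a => !f a :=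
  (cond hf (const false) (const true)).of_eq fun a => by cases f a <;> rfl


@[fun_prop]
theorem beq (hf : PT O f) (hg : PT O g) : PT O fun a => f a == g a :=
  (cond hf hg hg.not).of_eq fun a => by cases f a <;> simp

theorem polyBound_nat (hn : PT O n) : PolyBound n := by
  simpa using hn.polyBound

theorem succ (hn : PT O n) : PT O fun a => n a + 1 :=
  ((const_dat .nil).pair hn).congr_enc fun a => by simp

theorem pred (hn : PT O n) : PT O fun a => n a - 1 :=
  hn.encode.tl.congr_enc fun a => by cases n a <;> simp [Dat.tl]

theorem natCases {f : α → γ} {g : α → ℕ → γ} {h : α → γ} (hn : PT O n) (hf : PT O f)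
    (hg : PT O fun p : α × ℕ => g p.1 p.2) (h₀ : ∀ a, n a = 0 → h a = f a)
    (h₁ : ∀ a m, n a = m + 1 → h a = g a m) : PT O h := by
  refine branch hn.encode hf (hg.comp (PT.id.pair hn.pred)) (fun a ha => ?_) fun a ha => ?_
  · cases hna : n a with
    | zero => exact h₀ a hna
    | succ m => simp [hna] at ha
  · cases hna : n a with
    | zero => simp [hna] at ha
    | succ m => simpa using h₁ a m hna

theorem isZero (hn : PT O n) : PT O fun a => decide (n a = 0) :=
  natCases (g := fun _ _ => false) hn (const true) (const false) (fun a h => by simp [h])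
    fun a m h => by simp [h]

@[fun_prop]
theorem add (hm : PT O m) (hn : PT O n) : PT O fun a => m a + n a :=
  (iterate (step := fun _ x => x + 1) hn hm PT.id.snd.succ
    (hm.polyBound_nat.add hn.polyBound_nat) fun a i hi => by simpa using hi).of_eq
      fun a => by simp

@[fun_prop]
theorem sub (hm : PT O m) (hn : PT O n) : PT O fun a => m a - n a :=
  (iterate (step := fun _ => Nat.pred) hn hm PT.id.snd.pred hm.polyBound_nat
    fun a i _ => by simp [Nat.pred_iterate]).of_eq fun a => (Nat.pred_iterate _ _).symm

@[fun_prop]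
theorem mul (hm : PT O m) (hn : PT O n) : PT O fun a => m a * n a := by
  have hiter : ∀ c i : ℕ, (· + c)^[i] 0 = c * i := by simp [mul_comm]
  refine (iterate (step := fun a x => x + m a) hn (const 0) (by fun_prop)
    (hm.polyBound_nat.mul hn.polyBound_nat) fun a i hi => ?_).of_eq fun a => (hiter _ _).symm
  rw [hiter, sz_nat]
  gcongr

@[fun_prop]
theorem pow (hn : PT O n) (k : ℕ) : PT O fun a => n a ^ k := by
  induction k with
  | zero => simpa using const 1
  | succ k ih => simpa [pow_succ] using ih.mul hn

@[fun_prop]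
theorem le (hm : PT O m) (hn : PT O n) : PT O fun a => decide (m a ≤ n a) :=
  (hm.sub hn).isZero.of_eq fun a => by simp [Nat.sub_eq_zero_iff_le]

@[fun_prop]
theorem lt (hm : PT O m) (hn : PT O n) : PT O fun a => decide (m a < n a) :=
  le hm.succ hn

@[fun_prop]
theorem eq (hm : PT O m) (hn : PT O n) : PT O fun a => decide (m a = n a) :=
  ((hm.le hn).and (hn.le hm)).of_eq fun a => by simp [← Bool.decide_and, le_antisymm_iff]

@[fun_prop]
theorem max (hm : PT O m) (hn : PT O n) : PT O fun a => Max.max (m a) (n a) :=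
  (hm.add (hn.sub hm)).of_eq fun a => by omega

@[fun_prop]
theorem mod (hm : PT O m) (hn : PT O n) : PT O fun a => m a % n a := by
  have hiter : ∀ d i, (fun x => if x + 1 = d then 0 else x + 1)^[i] 0 = i % d := by
    intro d i
    induction i with
    | zero => simp
    | succ i ih =>
      rw [Function.iterate_succ_apply', ih]
      split_ifs with h
      · rw [← Nat.mod_add_mod, h, Nat.mod_self]
      · rcases d.eq_zero_or_pos with rfl | hd
        · simp
        · have := Nat.mod_lt i hd
          rw [← Nat.mod_add_mod, Nat.mod_eq_of_lt (show i % d + 1 < d by omega)]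
  refine (iterate (step := fun a x => if x + 1 = n a then 0 else x + 1) hm (const 0) (by fun_prop)
    hm.polyBound_nat fun a i hi => ?_).of_eq fun a => (hiter _ _).symm
  rw [hiter, sz_nat]
  exact (Nat.mod_le _ _).trans hi

@[fun_prop]
theorem size {e : α → Dat} (he : PT O e) : PT O fun a => (e a).size :=
  (iterateTree (init := fun _ => 0) (step := fun x : ℕ => x + 1) he (const 0) PT.id.succ
    he.polyBound fun a i hi => by simpa using hi).of_eq fun a => by simp

end

/-! ### Lists -/

section

variable {f : α → β} {l m : α → List β} {n : α → ℕ}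

@[fun_prop]
theorem cons (hf : PT O f) (hl : PT O l) : PT O fun a => f a :: l a :=
  (hf.pair hl).congr_enc fun _ => rfl

@[fun_prop]
theorem tail (hl : PT O l) : PT O fun a => (l a).tail :=
  hl.encode.tl.congr_enc fun a => by cases l a <;> rfl

@[fun_prop]
theorem headD (hl : PT O l) (hf : PT O f) : PT O fun a => (l a).headD (f a) :=
  listCases (g := fun _ b _ => b) hl hf (by fun_prop) (fun a h => by simp [h])
    fun a b t h => by simp [h]

@[fun_prop]
theorem isEmpty (hl : PT O l) : PT O fun a => (l a).isEmpty :=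
  listCases (g := fun _ _ _ => false) hl (const true) (const false) (fun a h => by simp [h])
    fun a b t h => by simp [h]

@[fun_prop]
theorem reverse (hl : PT O l) : PT O fun a => (l a).reverse := by
  refine (foldl (step := fun _ acc b => b :: acc) hl (const []) (by fun_prop) hl.polyBound
    fun a l' hl' => ?_).of_eq fun a => by simp
  simpa using sz_le_of_prefix hl'

@[fun_prop]
theorem append (hl : PT O l) (hm : PT O m) : PT O fun a => l a ++ m a := by
  refine (foldl (step := fun _ acc b => b :: acc) hl.reverse hm (by fun_prop)
    (hl.polyBound.add hm.polyBound) fun a l' hl' => ?_).of_eq fun a => by simp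
  simpa using sz_le_of_prefix hl'

theorem foldr {init : α → γ} {step : α → β → γ → γ} (hl : PT O l) (hi : PT O init)
    (hs : PT O fun p : α × β × γ => step p.1 p.2.1 p.2.2) {B : α → ℕ} (hB : PolyBound B)
    (hb : ∀ a l', l' <:+ l a → sz (l'.foldr (step a) (init a)) ≤ B a) :
    PT O fun a => (l a).foldr (step a) (init a) :=
  (foldl (step := fun a c b => step a b c) hl.reverse hi
    (hs.comp (f := fun p : α × γ × β => (p.1, p.2.2, p.2.1)) (by fun_prop)) hB fun a l' hl' => by
      simpa using hb a l'.reverse (by simpa using List.reverse_suffix.mpr hl')).of_eq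
        fun a => by simp

@[fun_prop]
theorem flatMap {f : α → β → List γ} (hl : PT O l) (hf : PT O fun p : α × β => f p.1 p.2) :
    PT O fun a => (l a).flatMap (f a) := by
  obtain ⟨k, hk⟩ := hf.polyBound
  refine (foldr (step := fun a b acc => f a b ++ acc) hl (const []) (by fun_prop)
    (hl.polyBound.mul (((PolyBound.size.add hl.polyBound).add (.const 3)).pow k))
    fun a l' hl' => ?_).of_eq fun a => by
      simp [List.flatMap_def]
  refine le_trans ?_ (Nat.mul_le_mul_right _ ((length_le_sz l').trans (sz_le_of_suffix hl')))
  have hmem : ∀ b ∈ l', sz b ≤ sz (l a) := fun b hb => (sz_le_of_mem (hl'.subset hb)).le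
  clear hl'
  induction l' with
  | nil => simp
  | cons b l' ih =>
    have htail := ih fun c hc => hmem c (by simp [hc])
    have hhead := (hk (a, b)).trans (Nat.pow_le_pow_left
      (show sz (a, b) + 2 ≤ sz a + sz (l a) + 3 by
        have := hmem b (by simp)
        simp only [sz_pair]
        omega) k)
    simp only [List.foldr_cons, sz_append, List.length_cons, Nat.succ_mul] at *
    omega

@[fun_prop]
theorem map {f : α → β → γ} (hl : PT O l) (hf : PT O fun p : α × β => f p.1 p.2) :
    PT O fun a => (l a).map (f a) :=
  (flatMap (f := fun a b => [f a b]) hl (by fun_prop)).of_eq fun a => List.map_eq_flatMap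

@[fun_prop]
theorem all {f : α → β → Bool} (hl : PT O l) (hf : PT O fun p : α × β => f p.1 p.2) :
    PT O fun a => (l a).all (f a) :=
  (foldr (step := fun a b acc => f a b && acc) hl (const true) (by fun_prop) (.const 1)
    fun a l' _ => sz_bool_le _).of_eq fun a => by induction l a <;> simp [*]

@[fun_prop]
theorem any {f : α → β → Bool} (hl : PT O l) (hf : PT O fun p : α × β => f p.1 p.2) :
    PT O fun a => (l a).any (f a) :=
  (foldr (step := fun a b acc => f a b || acc) hl (const false) (by fun_prop) (.const 1)
    fun a l' _ => sz_bool_le _).of_eq fun a => by induction l a <;> simp [*]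

@[fun_prop]
theorem countP {f : α → β → Bool} (hl : PT O l) (hf : PT O fun p : α × β => f p.1 p.2) :
    PT O fun a => (l a).countP (f a) := by
  have hfold : ∀ a (l : List β),
      l.foldr (fun b n => bif f a b then n + 1 else n) 0 = l.countP (f a) := by
    intro a l
    induction l with
    | nil => rfl
    | cons b l ih =>
      rw [List.countP_cons, List.foldr_cons, ih]
      cases f a b <;> simp
  refine (foldr (step := fun a b n => bif f a b then n + 1 else n) hl (const 0) (by fun_prop)
    hl.polyBound fun a l' hl' => ?_).of_eq fun a => (hfold a _).symm
  rw [hfold, sz_nat]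
  exact List.countP_le_length.trans ((length_le_sz _).trans (sz_le_of_suffix hl'))

@[fun_prop]
theorem length (hl : PT O l) : PT O fun a => (l a).length :=
  (countP (f := fun _ _ => true) hl (const true)).of_eq fun a => by simp

@[fun_prop]
theorem drop (hl : PT O l) (hn : PT O n) : PT O fun a => (l a).drop (n a) := by
  refine (iterate (step := fun _ => List.tail) hn hl (by fun_prop) hl.polyBound
    fun a i _ => ?_).of_eq fun a => by rw [List.tail_iterate]
  rw [List.tail_iterate]
  exact sz_le_of_suffix (List.drop_suffix _ _)

@[fun_prop]
theorem getD (hl : PT O l) (hn : PT O n) (hf : PT O f) : PT O fun a => (l a).getD (n a) (f a) :=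
  ((hl.drop hn).headD hf).of_eq fun a => by
    rw [List.headD_eq_head?_getD, List.head?_drop, List.getD_eq_getElem?_getD]

@[fun_prop]
theorem getLastD (hl : PT O l) (hf : PT O f) : PT O fun a => (l a).getLastD (f a) :=
  (hl.reverse.headD hf).of_eq fun a => by
    rw [List.headD_eq_head?_getD, List.head?_reverse, List.getLastD_eq_getLast?]

@[fun_prop]
theorem replicate (hf : PT O f) (hn : PT O n) : PT O fun a => List.replicate (n a) (f a) := by
  have hiter : ∀ (b : β) i, (List.cons b)^[i] [] = List.replicate i b := fun b i => by
    induction i with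
    | zero => rfl
    | succ i ih => rw [Function.iterate_succ_apply', ih, List.replicate_succ]
  refine (iterate (step := fun a => List.cons (f a)) hn (const []) (by fun_prop)
    (hn.polyBound_nat.mul (hf.polyBound.add (.const 1))) fun a i hi => ?_).of_eq
      fun a => (hiter _ _).symm
  rw [hiter]
  refine (sz_le_length_mul _ (sz (f a)) fun b hb => ?_).trans ?_
  · rw [List.eq_of_mem_replicate hb]
  · rw [List.length_replicate]
    gcongr

theorem dropWhile {f : β → Bool} (hl : PT O l) (hf : PT O f) :
    PT O fun a => (l a).dropWhile f := by
  have hfold : ∀ l : List β,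
      l.foldr (fun b p => (b :: p.1, bif f b then p.2 else b :: p.1)) ([], []) =
        (l, l.dropWhile f) := fun l => by
    induction l with
    | nil => rfl
    | cons b l ih => cases hb : f b <;> simp [ih, hb]
  refine (foldr (γ := List β × List β)
    (step := fun _ b p => (b :: p.1, bif f b then p.2 else b :: p.1)) hl (const ([], []))
    (by fun_prop) ((hl.polyBound.add hl.polyBound).add (.const 1)) fun a l' hl' => ?_).snd.of_eq
      fun a => by rw [hfold]
  have htail := sz_le_of_suffix (List.dropWhile_suffix (l := l') f)
  have hle := sz_le_of_suffix hl'
  rw [hfold, sz_pair]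
  omega

@[fun_prop]
theorem isPrefixOf {l m : α → List Bool} (hl : PT O l) (hm : PT O m) :
    PT O fun a => (l a).isPrefixOf (m a) := by
  let st : Bool × List Bool → Bool → Bool × List Bool := fun p b =>
    (p.1 && (!p.2.isEmpty && (p.2.headD false == b)), p.2.tail)
  have hrun : ∀ (l : List Bool) p,
      l.foldl st p = (p.1 && l.isPrefixOf p.2, p.2.drop l.length) := fun l => by
    induction l with
    | nil => simp
    | cons b l ih =>
      rintro ⟨ok, m⟩
      rw [List.foldl_cons, ih]
      cases m with
      | nil => simp [st]
      | cons c m => cases b <;> cases c <;> simp [st, List.isPrefixOf]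
  refine (foldl (step := fun _ => st) hl ((const true).pair hm) (by unfold st; fun_prop)
    (hm.polyBound.add (.const 2)) fun a l' _ => ?_).fst.of_eq fun a => by simp [hrun]
  have hdrop := sz_le_of_suffix (List.drop_suffix l'.length (m a))
  have hbool := sz_bool_le (true && l'.isPrefixOf (m a))
  simp only [hrun, sz_pair]
  omega

end

end PT

/-! ### Reading data from arbitrary trees -/

namespace Dat

/-- The list represented by a tree, with elements given by trees: the left subtrees along the
right spine. -/
def toList : Dat → List Dat
  | nil => []
  | cons a b => a :: toList b

/-- The Boolean represented by a tree; a tree that represents none is read as `true`. -/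
def toBool : Dat → Bool
  | nil => false
  | cons _ _ => true

theorem enc_toList (t : Dat) : enc t.toList = t := by
  induction t with
  | nil => rfl
  | cons a b _ ih => simp [toList, ih]

theorem toList_enc {α : Type} [Enc α] (l : List α) : (enc l).toList = l.map enc := by
  induction l with
  | nil => rfl
  | cons a l ih => simp [toList, ih]

theorem toBool_enc (b : Bool) : (enc b).toBool = b := by cases b <;> rfl

theorem size_enc (n : ℕ) : (enc n).size = n := sz_nat n

/-- The bit string represented by a tree. -/
def toBits (t : Dat) : List Bool := t.toList.map toBool

/-- The list of numbers represented by a tree. -/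
def toNats (t : Dat) : List ℕ := t.toList.map size

theorem toBits_enc (l : List Bool) : (enc l).toBits = l := by
  simp [toBits, toList_enc, Function.comp_def, toBool_enc]

theorem toNats_enc (l : List ℕ) : (enc l).toNats = l := by
  simp [toNats, toList_enc, Function.comp_def, size_enc]

end Dat

namespace PT

variable {O : Language Bool} {α : Type} [Enc α] {e : α → Dat}

@[fun_prop]
theorem toList (he : PT O e) : PT O fun a => (e a).toList :=
  he.congr_enc fun a => (e a).enc_toList

@[fun_prop]
theorem toBool (he : PT O e) : PT O fun a => (e a).toBool :=
  branch he (const false) (const true) (fun a h => by simp [h, Dat.toBool]) fun a h => by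
    cases hea : e a with
    | nil => exact absurd hea h
    | cons x y => rfl

@[fun_prop]
theorem toBits (he : PT O e) : PT O fun a => (e a).toBits := by
  unfold Dat.toBits
  fun_prop

@[fun_prop]
theorem toNats (he : PT O e) : PT O fun a => (e a).toNats := by
  unfold Dat.toNats
  fun_prop

end PT

/-! ### Simulation of machines -/

namespace PT

variable {O : Language Bool} {α β : Type} [Enc α] [Enc β]

theorem finiteCases {σ : Type} [Finite σ] [Nonempty σ] {q : α → σ} {h : σ → α → β}
    (hq : ∀ s, PT O fun a => (open Classical in decide (q a = s))) (hh : ∀ s, PT O (h s)) :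
    PT O fun a => h (q a) a := by
  classical
  have := Fintype.ofFinite σ
  have hpart : ∀ S : Finset σ, ∃ f : α → β, PT O f ∧ ∀ a, q a ∈ S → f a = h (q a) a := by
    intro S
    induction S using Finset.induction_on with
    | empty => exact ⟨h (Classical.arbitrary σ), hh _, by simp⟩
    | insert s S _ ih =>
      obtain ⟨f, hf, hfS⟩ := ih
      refine ⟨fun a => if q a = s then h s a else f a, ite (hq s) (hh s) hf, fun a ha => ?_⟩
      by_cases hs : q a = s
      · simp [hs]
      · simpa [hs] using hfS a (Finset.mem_of_mem_insert_of_ne ha hs)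
  obtain ⟨f, hf, hfh⟩ := hpart Finset.univ
  exact hf.of_eq fun a => (hfh a (Finset.mem_univ _)).symm

theorem ofFn {r : ℕ} {F : Fin r → α → β} (hF : ∀ i, PT O (F i)) :
    PT O fun a => List.ofFn fun i => F i a := by
  induction r with
  | zero => simpa using const []
  | succ r ih =>
    simp only [List.ofFn_succ]
    exact (hF 0).cons (ih fun i => hF i.succ)

end PT

namespace Machine

variable {M : Machine}

/-- The number of the state of a configuration. -/
noncomputable def stateIndex (c : M.Cfg) : ℕ := Fintype.equivFin M.State c.state

/-- The contents of all stacks, as a list. -/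
noncomputable def stackList (c : M.Cfg) : List (List Bool) :=
  List.ofFn fun i => c.stk ((Fintype.equivFin M.Stack).symm i)

noncomputable instance : Enc M.Cfg := ⟨fun c => enc (stateIndex c, stackList c)⟩

theorem length_stk_init_le (x : List Bool) (k : M.Stack) :
    ((M.init x).stk k).length ≤ x.length := by
  simp only [init]
  split_ifs <;> simp

theorem length_stk_step_le (O : Language Bool) (c : M.Cfg) (b : Bool) (k : M.Stack) :
    ((M.step O c b).stk k).length ≤ (c.stk k).length + 1 := by
  unfold step
  split
  all_goals try split
  all_goals grind [Function.update_apply]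

theorem length_stk_run_le (O : Language Bool) (g : List Bool) (c : M.Cfg) (k : M.Stack) :
    ((M.run O g c).stk k).length ≤ (c.stk k).length + g.length := by
  induction g generalizing c with
  | nil => simp [run]
  | cons b g ih =>
    have hrun := ih (M.step O c b)
    have hstep := length_stk_step_le O c b k
    simp only [run, List.foldl_cons, List.length_cons] at *
    omega

theorem sz_cfg_le (c : M.Cfg) (B : ℕ) (hB : ∀ k, (c.stk k).length ≤ B) :
    sz c ≤ Fintype.card M.State + Fintype.card M.Stack * (2 * B + 1) + 1 := by
  have hstate : stateIndex c ≤ Fintype.card M.State := (Fin.isLt _).le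
  have hstacks : sz (stackList c) ≤ Fintype.card M.Stack * (2 * B + 1) := by
    refine (sz_le_length_mul _ (2 * B) fun l hl => ?_).trans (by simp [stackList])
    obtain ⟨i, rfl⟩ := List.mem_ofFn.mp hl
    exact (sz_bits_le _).trans (Nat.mul_le_mul_left 2 (hB _))
  have hsz : sz c = stateIndex c + sz (stackList c) + 1 := by
    rw [← sz_nat (stateIndex c)]
    rfl
  omega

end Machine

namespace PT

variable {M : Machine} {O : Language Bool} {α : Type} [Enc α] {c : α → M.Cfg}

theorem stateIndex (hc : PT O c) : PT O fun a => Machine.stateIndex (c a) :=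
  (hc.congr_enc (g := fun a => (Machine.stateIndex (c a), Machine.stackList (c a)))
    fun _ => rfl).fst

open Classical in
theorem state_eq (hc : PT O c) (q : M.State) : PT O fun a => decide ((c a).state = q) :=
  (hc.stateIndex.eq (const (Fintype.equivFin M.State q : ℕ))).of_eq fun a => by
    simp [Machine.stateIndex, Fin.val_inj]

@[fun_prop]
theorem stk (hc : PT O c) (k : M.Stack) : PT O fun a => (c a).stk k := by
  have hstacks := (hc.congr_enc
    (g := fun a => (Machine.stateIndex (c a), Machine.stackList (c a))) fun _ => rfl).snd
  refine (hstacks.getD (const (Fintype.equivFin M.Stack k : ℕ)) (const [])).of_eq fun a => ?_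
  simp [Machine.stackList, List.getD_eq_getElem?_getD]

@[fun_prop]
theorem cfg (q : M.State) {F : α → M.Stack → List Bool} (hF : ∀ k, PT O fun a => F a k) :
    PT O fun a => (⟨q, F a⟩ : M.Cfg) :=
  ((const (Fintype.equivFin M.State q : ℕ)).pair (ofFn
    (F := fun i a => F a ((Fintype.equivFin M.Stack).symm i)) fun _ => hF _)).congr_enc
      fun _ => rfl

@[fun_prop]
theorem cfg_update (q : M.State) (hc : PT O c) (k : M.Stack) {l : α → List Bool}
    (hl : PT O l) : PT O fun a => (⟨q, Function.update (c a).stk k (l a)⟩ : M.Cfg) :=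
  cfg q fun k' => by
    rcases eq_or_ne k' k with rfl | h
    · simpa using hl
    · simpa [Function.update_of_ne h] using hc.stk k'

theorem step (hM : M.QueryFree) : PT O fun p : M.Cfg × Bool => M.step ⊥ p.1 p.2 := by
  have : Nonempty M.State := ⟨M.start⟩
  suffices h : ∀ q : M.State, PT O fun p : M.Cfg × Bool => M.step ⊥ ⟨q, p.1.stk⟩ p.2 from
    finiteCases (h := fun q (p : M.Cfg × Bool) => M.step ⊥ ⟨q, p.1.stk⟩ p.2)
      (PT.id.fst.state_eq ·) h
  intro q
  cases hq : M.prog q with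
  | push k a q =>
    simp only [Machine.step, hq]
    fun_prop
  | pop k qe q₀ q₁ =>
    refine listCases (l := fun p => p.1.stk k) (f := fun p => ⟨qe, p.1.stk⟩)
      (g := fun p b s => bif b then ⟨q₁, Function.update p.1.stk k s⟩
        else ⟨q₀, Function.update p.1.stk k s⟩) (by fun_prop) (by fun_prop) (by fun_prop)
      (fun p h => by simp [Machine.step, hq, h]) fun p b s h => by
        cases b <;> simp [Machine.step, hq, h]
  | guess q₀ q₁ =>
    refine (cond (f := fun p => ⟨q₁, p.1.stk⟩) (g := fun p => ⟨q₀, p.1.stk⟩) PT.id.snd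
      (by fun_prop) (by fun_prop)).of_eq fun p => ?_
    cases hp : p.2 <;> simp [Machine.step, hq]
  | query k qyes qno => exact absurd hq (hM q k qyes qno)
  | halt _ =>
    simp only [Machine.step, hq]
    fun_prop

variable {x g : α → List Bool}

theorem run (hM : M.QueryFree) (hx : PT O x) (hg : PT O g) :
    PT O fun a => M.run ⊥ (g a) (M.init (x a)) := by
  have hinit : PT O fun a => M.init (x a) := cfg M.start fun k => by
    by_cases h : k = M.inp
    · simpa [h] using hx
    · simpa [h] using const []
  refine foldl (step := fun _ c b => M.step ⊥ c b) hg hinit ((step hM).comp PT.id.snd)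
    (((PolyBound.const _).add ((PolyBound.const _).mul (((PolyBound.const 2).mul
      (hx.polyBound.add hg.polyBound)).add (.const 1)))).add (.const 1)) fun a l' hl' =>
    Machine.sz_cfg_le _ _ fun k => (Machine.length_stk_run_le ⊥ l' _ k).trans ?_
  have hlen := (length_le_sz l').trans (sz_le_of_prefix hl')
  have hinp := (Machine.length_stk_init_le (x a) k).trans (length_le_sz (x a))
  omega

open Classical in
theorem accepting (hM : M.QueryFree) (hx : PT O x) (hg : PT O g) :
    PT O fun a => decide (M.run ⊥ (g a) (M.init (x a))).Accepting :=
  have : Nonempty M.State := ⟨M.start⟩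
  finiteCases (h := fun q _ => decide (M.prog q = .halt true)) ((run hM hx hg).state_eq ·)
    fun _ => const _

end PT

/-! ### Evaluation of circuits -/

namespace Gate

/-- The number of the type of a gate. -/
def tag : Gate → ℕ
  | input _ => 0
  | not _ => 1
  | and _ => 2
  | or _ => 3
  | mod _ => 4

/-- The numbers that occur in a gate: the number of the input bit, or the arguments. -/
def nums : Gate → List ℕ
  | input i => [i]
  | g => g.args

instance : Enc Gate := ⟨fun g => enc (g.tag, g.nums)⟩

/-- The gate with the given type and numbers. -/
def ofTag : ℕ → List ℕ → Gate
  | 0, js => input (js.headD 0)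
  | 1, js => not (js.headD 0)
  | 2, js => and js
  | 3, js => or js
  | _, js => mod js

theorem ofTag_tag_nums (g : Gate) : ofTag g.tag g.nums = g := by
  cases g <;> simp [tag, nums, args, ofTag]

theorem enc_ofTag (t : ℕ) (js : List ℕ) :
    enc (ofTag t js) = enc (if 4 ≤ t then 4 else t, if t ≤ 1 then [js.headD 0] else js) := by
  match t with
  | 0 | 1 | 2 | 3 => rfl
  | t + 4 => simp [ofTag, enc, tag, nums, args]

end Gate

/-- The gate represented by a tree. -/
def Dat.toGate (t : Dat) : Gate := .ofTag t.hd.size t.tl.toNats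

theorem Dat.toGate_enc (g : Gate) : (enc g).toGate = g := by
  have h : (enc g).toGate = .ofTag (enc g.tag).size (enc g.nums).toNats := rfl
  rw [h, size_enc, toNats_enc, g.ofTag_tag_nums]

namespace PT

variable {O : Language Bool} {α : Type} [Enc α] {g : α → Gate} {n pos : α → ℕ}

@[fun_prop]
theorem tag (hg : PT O g) : PT O fun a => (g a).tag :=
  (hg.congr_enc (g := fun a => ((g a).tag, (g a).nums)) fun _ => rfl).fst

@[fun_prop]
theorem nums (hg : PT O g) : PT O fun a => (g a).nums :=
  (hg.congr_enc (g := fun a => ((g a).tag, (g a).nums)) fun _ => rfl).snd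

@[fun_prop]
theorem toGate {e : α → Dat} (he : PT O e) : PT O fun a => (e a).toGate :=
  congr_enc (f := fun a => (if 4 ≤ (e a).hd.size then 4 else (e a).hd.size,
    if (e a).hd.size ≤ 1 then [(e a).tl.toNats.headD 0] else (e a).tl.toNats)) (by fun_prop)
    fun _ => Gate.enc_ofTag _ _

@[fun_prop]
theorem gateEval {m : ℕ} {x v : α → List Bool} (hx : PT O x) (hv : PT O v) (hg : PT O g) :
    PT O fun a => (g a).eval m (x a) (v a) := by
  refine of_eq (f := fun a => if (g a).tag = 0 then (x a).getD ((g a).nums.headD 0) false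
    else if (g a).tag = 1 then !(v a).getD ((g a).nums.headD 0) false
    else if (g a).tag = 2 then (g a).nums.all fun j => (v a).getD j false
    else if (g a).tag = 3 then (g a).nums.any fun j => (v a).getD j false
    else decide (((g a).nums.countP fun j => (v a).getD j false) % m = 0)) (by fun_prop)
    fun a => ?_
  cases g a <;> simp [Gate.eval, Gate.tag, Gate.nums, Gate.args, Nat.dvd_iff_mod_eq_zero]

@[fun_prop]
theorem gateArgs (hg : PT O g) : PT O fun a => (g a).args :=
  of_eq (f := fun a => if (g a).tag = 0 then [] else (g a).nums) (by fun_prop) fun a => by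
    cases g a <;> simp [Gate.tag, Gate.nums, Gate.args]

@[fun_prop]
theorem foldrMax {l : α → List ℕ} (hl : PT O l) : PT O fun a => (l a).foldr Max.max 0 := by
  refine foldr (step := fun _ b c => Max.max b c) hl (const 0) (by fun_prop) hl.polyBound
    fun a l' hl' => (sz_nat _).trans_le ?_
  refine (List.max_le_of_forall_le l' _ fun b hb => ?_).trans (sz_le_of_suffix hl')
  exact (sz_nat b).symm.trans_le (sz_le_of_mem hb).le

@[fun_prop]
theorem gateDepth {d : α → List ℕ} (hd : PT O d) (hg : PT O g) :
    PT O fun a => (g a).depth (d a) :=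
  of_eq (f := fun a => if (g a).tag = 0 then 0
    else ((g a).args.map fun j => (d a).getD j 0).foldr Max.max 0 + 1) (by fun_prop) fun a => by
      cases g a <;> simp [Gate.depth, Gate.tag]

@[fun_prop]
theorem encodeNat (hn : PT O n) : PT O fun a => encodeNat (n a) := by
  unfold ACCUniform.encodeNat
  fun_prop

@[fun_prop]
theorem encodeArgs {l : α → List ℕ} (hl : PT O l) : PT O fun a => encodeArgs (l a) := by
  unfold ACCUniform.encodeArgs
  fun_prop

@[fun_prop]
theorem gateEncode (hg : PT O g) : PT O fun a => (g a).encode :=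
  of_eq (f := fun a =>
    if (g a).tag = 0 then false :: false :: ACCUniform.encodeNat ((g a).nums.headD 0)
    else if (g a).tag = 1 then false :: true :: ACCUniform.encodeNat ((g a).nums.headD 0)
    else if (g a).tag = 2 then true :: false :: false :: ACCUniform.encodeArgs (g a).nums
    else if (g a).tag = 3 then true :: false :: true :: ACCUniform.encodeArgs (g a).nums
    else true :: true :: ACCUniform.encodeArgs (g a).nums) (by fun_prop) fun a => by
      cases g a <;> simp [Gate.encode, Gate.tag, Gate.nums, Gate.args]

open Classical in
@[fun_prop]
theorem wellFormed (hn : PT O n) (hp : PT O pos) (hg : PT O g) :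
    PT O fun a => decide ((g a).WellFormed (n a) (pos a)) :=
  of_eq (f := fun a => (g a).nums.all fun j => decide (j < if (g a).tag = 0 then n a else pos a))
    (by fun_prop) fun a => by
      rw [Bool.eq_iff_iff, decide_eq_true_iff]
      cases g a <;> simp [Gate.WellFormed, Gate.tag, Gate.nums, Gate.args]

end PT

/-- The list of gates is the list of gates of some circuit with `n` inputs. -/
def IsCircuit (n : ℕ) (G : List Gate) : Prop :=
  G ≠ [] ∧ ∀ (i : ℕ) (h : i < G.length), G[i].WellFormed n i

/-- The values of the gates of a list on the input `x`. -/
def gateValues (m : ℕ) (x : List Bool) (G : List Gate) : List Bool :=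
  G.foldl (fun v g => v ++ [g.eval m x v]) []

/-- The depths of the gates of a list. -/
def gateDepths (G : List Gate) : List ℕ :=
  G.foldl (fun d g => d ++ [g.depth d]) []

/-- The value of the last gate of a list on the input `x`. -/
def gateOutput (m : ℕ) (G : List Gate) (x : List Bool) : Bool :=
  (gateValues m x G).getLastD false

/-- The largest depth of a gate of a list. -/
def maxDepth (G : List Gate) : ℕ := (gateDepths G).foldr max 0

theorem Gate.depth_le {d : List ℕ} {c : ℕ} (h : ∀ a ∈ d, a ≤ c) (g : Gate) :
    g.depth d ≤ c + 1 := by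
  have hargs : (g.args.map fun j => d.getD j 0).foldr max 0 ≤ c := by
    refine List.max_le_of_forall_le _ _ fun a ha => ?_
    obtain ⟨j, -, rfl⟩ := List.mem_map.mp ha
    rw [List.getD_eq_getElem?_getD]
    rcases hj : d[j]? with _ | b
    · simp
    · exact h b (List.mem_of_getElem? hj)
  cases g with
  | input i => simp [Gate.depth]
  | _ => exact Nat.succ_le_succ hargs

theorem length_gateValues (m : ℕ) (x : List Bool) (G : List Gate) :
    (gateValues m x G).length = G.length := by
  induction G using List.reverseRecOn with
  | nil => rfl
  | append_singleton G g ih => simpa [gateValues] using ih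

theorem length_gateDepths (G : List Gate) : (gateDepths G).length = G.length := by
  induction G using List.reverseRecOn with
  | nil => rfl
  | append_singleton G g ih => simpa [gateDepths] using ih

theorem le_length_of_mem_gateDepths (G : List Gate) : ∀ a ∈ gateDepths G, a ≤ G.length := by
  induction G using List.reverseRecOn with
  | nil => simp [gateDepths]
  | append_singleton G g ih =>
    have h : gateDepths (G ++ [g]) = gateDepths G ++ [g.depth (gateDepths G)] := by
      simp [gateDepths]
    intro a ha
    rw [h, List.mem_append, List.mem_singleton] at ha
    rw [List.length_append, List.length_singleton]
    rcases ha with ha | rfl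
    · exact (ih a ha).trans (Nat.le_succ _)
    · exact g.depth_le ih

theorem maxDepth_le_length (G : List Gate) : maxDepth G ≤ G.length :=
  List.max_le_of_forall_le _ _ (le_length_of_mem_gateDepths G)

namespace PT

variable {O : Language Bool} {α : Type} [Enc α] {G : α → List Gate} {x : α → List Bool} {n : α → ℕ}

@[fun_prop]
theorem range (hn : PT O n) : PT O fun a => List.range (n a) := by
  have h (i : ℕ) : (fun l : List ℕ => l ++ [l.length])^[i] [] = List.range i := by
    induction i with
    | zero => rfl
    | succ i ih => rw [Function.iterate_succ_apply', ih, List.length_range, List.range_succ]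
  refine (iterate (step := fun _ (l : List ℕ) => l ++ [l.length]) hn (const []) (by fun_prop)
    (hn.polyBound_nat.mul (hn.polyBound_nat.add (.const 1))) fun a i hi => ?_).of_eq
      fun a => (h (n a)).symm
  rw [h]
  refine (sz_le_length_mul (List.range i) (n a) fun j hj => ?_).trans ?_
  · rw [sz_nat]
    exact (List.mem_range.mp hj).le.trans hi
  · rw [List.length_range]
    gcongr

open Classical in
@[fun_prop]
theorem isCircuit (hn : PT O n) (hG : PT O G) : PT O fun a => decide (IsCircuit (n a) (G a)) := by
  have hall := all (f := fun a i => decide (((G a).getD i (.and [])).WellFormed (n a) i))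
    (range hG.length) (by fun_prop)
  refine (hG.isEmpty.not.and hall).of_eq fun a => ?_
  rw [Bool.eq_iff_iff, decide_eq_true_iff]
  simp +contextual [IsCircuit]

@[fun_prop]
theorem gateValues {m : ℕ} (hG : PT O G) (hx : PT O x) :
    PT O fun a => gateValues m (x a) (G a) := by
  refine foldl (step := fun a v g => v ++ [g.eval m (x a) v]) hG (const []) (by fun_prop)
    ((PolyBound.const 2).mul hG.polyBound) fun a l hl => ?_
  refine (sz_bits_le _).trans (Nat.mul_le_mul_left 2 ?_)
  exact (length_gateValues m (x a) l).trans_le ((length_le_sz l).trans (sz_le_of_prefix hl))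

@[fun_prop]
theorem gateOutput {m : ℕ} (hG : PT O G) (hx : PT O x) :
    PT O fun a => gateOutput m (G a) (x a) := by
  unfold ACCUniform.gateOutput
  fun_prop

@[fun_prop]
theorem gateDepths (hG : PT O G) : PT O fun a => gateDepths (G a) := by
  refine foldl (step := fun _ d g => d ++ [g.depth d]) hG (const []) (by fun_prop)
    (hG.polyBound.mul (hG.polyBound.add (.const 1))) fun a l hl => ?_
  have hlen : l.length ≤ sz (G a) := (length_le_sz l).trans (sz_le_of_prefix hl)
  refine (sz_le_length_mul (ACCUniform.gateDepths l) (sz (G a)) fun b hb => ?_).trans ?_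
  · rw [sz_nat]
    exact (le_length_of_mem_gateDepths l b hb).trans hlen
  · rw [length_gateDepths]
    gcongr

@[fun_prop]
theorem maxDepth (hG : PT O G) : PT O fun a => maxDepth (G a) := by
  unfold ACCUniform.maxDepth
  fun_prop

end PT

/-! ### The lexicographic order on bit strings -/

theorem cons_le_cons_iff {x y : Bool} {a b : List Bool} :
    x :: a ≤ y :: b ↔ x < y ∨ x = y ∧ a ≤ b := by
  simp only [le_iff_lt_or_eq, List.cons_lt_cons_iff, List.cons.injEq]
  tauto

theorem append_le_append_iff_of_length_eq {a b : List Bool} (hab : a.length = b.length)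
    (s t : List Bool) : a ++ s ≤ b ++ t ↔ a < b ∨ a = b ∧ s ≤ t := by
  induction a generalizing b with
  | nil =>
    obtain rfl := List.length_eq_zero_iff.mp hab.symm
    simp
  | cons x a ih =>
    obtain _ | ⟨y, b⟩ := b
    · simp at hab
    · simp only [List.cons_append, cons_le_cons_iff, List.cons_lt_cons_iff, List.cons.injEq,
        ih (Nat.succ.inj hab)]
      tauto

theorem le_of_replicate_le_replicate {d e : ℕ} {s t : List Bool}
    (h : List.replicate d false ++ true :: s ≤ List.replicate e false ++ true :: t) : e ≤ d := by
  induction e generalizing d with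
  | zero => exact d.zero_le
  | succ e ih =>
    cases d with
    | zero => simp [List.replicate_succ, cons_le_cons_iff, Bool.lt_iff] at h
    | succ d =>
      refine Nat.succ_le_succ (ih ?_)
      simpa [List.replicate_succ, cons_le_cons_iff] using h

/-- The binary representation of `k` with `n` digits, the most significant digit first. -/
def bits : ℕ → ℕ → List Bool
  | 0, _ => []
  | n + 1, k => bits n (k / 2) ++ [decide (k % 2 = 1)]

theorem length_bits (n k : ℕ) : (bits n k).length = n := by
  induction n generalizing k with
  | zero => rfl
  | succ n ih => simp [bits, ih]

theorem bits_le_bits_iff {n k l : ℕ} (hk : k < 2 ^ n) (hl : l < 2 ^ n) :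
    bits n k ≤ bits n l ↔ k ≤ l := by
  induction n generalizing k l with
  | zero => simp [bits, Nat.lt_one_iff.mp hk]
  | succ n ih =>
    rw [pow_succ'] at hk hl
    have hkl := ih (k := k / 2) (l := l / 2) (by omega) (by omega)
    have hlk := ih (k := l / 2) (l := k / 2) (by omega) (by omega)
    have hlt : bits n (k / 2) < bits n (l / 2) ↔ k / 2 < l / 2 := by rw [← not_le, hlk, not_le]
    have heq : bits n (k / 2) = bits n (l / 2) ↔ k / 2 = l / 2 := by
      rw [le_antisymm_iff, hkl, hlk, le_antisymm_iff]
    rw [bits, bits, append_le_append_iff_of_length_eq (by simp [length_bits]), hlt, heq]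
    by_cases hk2 : k % 2 = 1 <;> by_cases hl2 : l % 2 = 1 <;>
      simp [hk2, hl2, cons_le_cons_iff, Bool.lt_iff] <;> omega

/-- The string of length `L`, in reverse, whose bits are found one after the other: the next bit
after the reverse of `w` is true if `q (true :: w)` holds. -/
def greedy (q : List Bool → Bool) (L : ℕ) : List Bool :=
  (fun w => q (true :: w) :: w)^[L] []

theorem greedy_succ (q : List Bool → Bool) (L : ℕ) :
    greedy q (L + 1) = q (true :: greedy q L) :: greedy q L :=
  Function.iterate_succ_apply' ..

theorem length_greedy (q : List Bool → Bool) (L : ℕ) : (greedy q L).length = L := by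
  induction L with
  | zero => rfl
  | succ L ih => rw [greedy_succ, List.length_cons, ih]

theorem take_succ_le {s w : List Bool} {i : ℕ} {b : Bool} (hi : i < s.length)
    (hw : w.length = i) (h : s.take i ≤ w) (hb : s.take i = w → s[i] ≤ b) :
    s.take (i + 1) ≤ w ++ [b] := by
  rw [List.take_succ_eq_append_getElem hi, append_le_append_iff_of_length_eq (by simp; omega)]
  refine (lt_or_eq_of_le h).imp_right fun h => ⟨h, ?_⟩
  simpa only [cons_le_cons_iff, le_refl, and_true, ← le_iff_lt_or_eq] using hb h

theorem isGreatest_greedy {S : Set (List Bool)} {q : List Bool → Bool} {L : ℕ}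
    (hq : ∀ w, q w = true ↔ ∃ s ∈ S, w.reverse <+: s) (hS : S.Nonempty)
    (hL : ∀ s ∈ S, s.length = L) : IsGreatest S (greedy q L).reverse := by
  have key : ∀ i ≤ L, (∃ s ∈ S, (greedy q i).reverse <+: s) ∧
      ∀ s ∈ S, s.take i ≤ (greedy q i).reverse := by
    intro i hi
    induction i with
    | zero => simpa [greedy, Set.Nonempty] using hS
    | succ i ih =>
      obtain ⟨⟨s, hs, hws⟩, hmax⟩ := ih (by omega)
      rw [greedy_succ, List.reverse_cons]
      set w := greedy q i with hw
      have hlen : w.reverse.length = i := by rw [List.length_reverse, hw, length_greedy]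
      have hnext {u : List Bool} (hu : u ∈ S) (hwu : w.reverse = u.take i) :
          w.reverse ++ [u[i]'(by rw [hL u hu]; omega)] <+: u := by
        rw [hwu, ← List.take_succ_eq_append_getElem]
        exact List.take_prefix ..
      have htrue {u : List Bool} (hu : u ∈ S) (hwu : w.reverse = u.take i)
          (hui : u[i]'(by rw [hL u hu]; omega) = true) : q (true :: w) = true := by
        refine (hq _).mpr ⟨u, hu, ?_⟩
        simpa [hui] using hnext hu hwu
      constructor
      · cases hqw : q (true :: w)
        · have hs' : w.reverse = s.take i := hlen ▸ List.prefix_iff_eq_take.mp hws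
          refine ⟨s, hs, ?_⟩
          have hsi : s[i]'(by rw [hL s hs]; omega) = false :=
            Bool.eq_false_iff.mpr fun h => by simp [htrue hs hs' h] at hqw
          exact hsi ▸ hnext hs hs'
        · simpa using (hq _).mp hqw
      · refine fun u hu => take_succ_le (by rw [hL u hu]; omega) hlen (hmax u hu) fun h => ?_
        exact Bool.le_iff_imp.mpr fun hui => htrue hu h.symm hui
  obtain ⟨⟨s, hs, hws⟩, hmax⟩ := key L le_rfl
  refine ⟨?_, fun u hu => ?_⟩
  · rwa [hws.eq_of_length (by rw [List.length_reverse, length_greedy, hL s hs])]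
  · simpa [List.take_of_length_le (hL u hu).le] using hmax u hu

namespace PT

variable {O : Language Bool} {α : Type} [Enc α] {n k : α → ℕ}

@[fun_prop]
theorem half (hn : PT O n) : PT O fun a => n a / 2 := by
  have h (n : ℕ) : (List.range n).countP (fun i => decide (i % 2 = 1)) = n / 2 := by
    induction n with
    | zero => rfl
    | succ n ih =>
      rw [List.range_succ, List.countP_append, ih]
      by_cases hn : n % 2 = 1 <;> simp [hn] <;> omega
  exact PT.of_eq (f := fun a => (List.range (n a)).countP fun i => decide (i % 2 = 1))
    (by fun_prop) fun a => (h (n a)).symm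

@[fun_prop]
theorem bits (hn : PT O n) (hk : PT O k) : PT O fun a => bits (n a) (k a) := by
  have hiter (n k : ℕ) (l : List Bool) :
      (fun p : ℕ × List Bool => (p.1 / 2, decide (p.1 % 2 = 1) :: p.2))^[n] (k, l) =
        (k / 2 ^ n, ACCUniform.bits n k ++ l) := by
    induction n generalizing k l with
    | zero => simp [ACCUniform.bits]
    | succ n ih =>
      rw [Function.iterate_succ_apply, ih, ACCUniform.bits, List.append_cons,
        Nat.div_div_eq_div_mul, pow_succ']
  refine (iterate (step := fun _ (p : ℕ × List Bool) => (p.1 / 2, decide (p.1 % 2 = 1) :: p.2)) hn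
    (hk.pair (const [])) (by fun_prop) ((hk.polyBound_nat.add
      ((PolyBound.const 2).mul hn.polyBound_nat)).add (.const 1)) fun a i hi => ?_).snd.of_eq
        fun a => by rw [hiter, List.append_nil]
  rw [hiter, sz_pair, sz_nat]
  have hdiv := Nat.div_le_self (k a) (2 ^ i)
  have hbits := sz_bits_le (ACCUniform.bits i (k a) ++ [])
  rw [List.append_nil, length_bits] at hbits
  rw [List.append_nil]
  omega

@[fun_prop]
theorem greedy {q : α → List Bool → Bool} (hq : PT O fun p : α × List Bool => q p.1 p.2)
    (hn : PT O n) : PT O fun a => greedy (q a) (n a) := by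
  refine iterate (step := fun a w => q a (true :: w) :: w) hn (const []) (by fun_prop)
    ((PolyBound.const 2).mul hn.polyBound_nat) fun a i hi => (sz_bits_le _).trans ?_
  exact Nat.mul_le_mul_left 2 ((length_greedy (q a) i).trans_le hi)

end PT

/-! ### Functions computed in exponential time -/

section

variable {O : Language Bool} {α β γ : Type} [Enc α] [Enc β] [Enc γ]

theorem PT.et {f : α → β} (hf : PT O f) : ET O f :=
  hf.imp fun _ ht => ⟨ht.1, ht.2.expBound⟩

namespace ExpBound

theorem const (c : ℕ) : ExpBound fun _ : α => c := (PolyBound.const c).expBound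

theorem size : ExpBound fun a : α => sz a := PolyBound.size.expBound

end ExpBound

namespace ET

theorem pair {f : α → β} {g : α → γ} (hf : ET O f) (hg : ET O g) : ET O fun a => (f a, g a) := by
  have hs := hf.expBound_sz
  have hs' := hg.expBound_sz
  obtain ⟨t, ht, hp⟩ := hf
  obtain ⟨u, hu, hq⟩ := hg
  refine ⟨.pair t u, fun a => by simp [Fn.eval, ht, hu], ?_⟩
  refine ((hp.add hq).add ((ExpBound.const 30).mul
    (((ExpBound.size.add hs).add hs').add (.const 1)))).mono fun a => ?_
  simp [Fn.cost, ht, hu, sz]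

theorem iterateTree {e : α → Dat} {init : α → γ} {step : γ → γ} (he : ET O e) (hi : ET O init)
    (hs : PT O step) {B : α → ℕ} (hB : ExpBound B)
    (hb : ∀ a, ∀ i ≤ (e a).size, sz (step^[i] (init a)) ≤ B a) :
    ET O fun a => step^[(e a).size] (init a) := by
  have hes := he.expBound_sz
  have his := hi.expBound_sz
  obtain ⟨t, ht, hp⟩ := he
  obtain ⟨u, hu, hq⟩ := hi
  obtain ⟨v, hv, k, hr⟩ := hs
  refine ⟨.comp (.iter v) (.pair t u), fun a => ?_, ?_⟩
  · simp [Fn.eval, ht, hu, Fn.eval_iterate hv]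
  · refine (((hp.add hq).add ((ExpBound.const 30).mul (((ExpBound.size.add hes).add his).add
      (.const 1)))).add (((ExpBound.const 30).mul ((hes.add hB).add (.const 2))).add
      ((ExpBound.const 30).mul ((hes.mul ((hB.add (.const 2)).pow k)).add hB)))).mono fun a => ?_
    exact Fn.cost_iter_pair_le hv hr (ht a) (hu a) (hb a)

end ET

theorem ExpBound.two_pow_size : ExpBound fun a : α => 2 ^ sz a := ⟨1, fun a => by simp⟩

theorem ET.mul_two_pow (c : ℕ) : ET O fun z : Dat => c * 2 ^ (c * z.size) := by
  have h (i : ℕ) : (fun x => 2 ^ c * x)^[i] c = c * 2 ^ (c * i) := by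
    induction i with
    | zero => simp
    | succ i ih => rw [Function.iterate_succ_apply', ih]; ring
  have hiter := iterateTree (e := fun z : Dat => z) (step := fun x => 2 ^ c * x)
    PT.id.et (PT.const (O := O) c).et (by fun_prop) (B := fun z => c * 2 ^ (c * sz z))
    ⟨c, fun z => le_rfl⟩ fun z i hi => by
      rw [h, sz_nat]
      have := hi.trans (sz_dat z).ge
      gcongr
      norm_num
  simpa only [h] using hiter

theorem mem_NE_of_certificates {r : Dat → β} {V : Dat × β × Dat → Bool} {u : Dat → ℕ}
    (hr : ET ⊥ r) (hV : PT ⊥ V) (hu : ExpBound u) {L : Language Bool}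
    (hsound : ∀ x t, V (.ofCode x, r (.ofCode x), t) = true → x ∈ L)
    (hcomplete : ∀ x ∈ L, ∃ t : Dat, t.size ≤ u (.ofCode x) ∧
      V (.ofCode x, r (.ofCode x), t) = true) : L ∈ NE := by
  obtain ⟨c, hc⟩ := hu
  have hV' : PT ⊥ fun p : (Dat × β × ℕ) × Dat => V (p.1.1, p.1.2.1, p.2) :=
    hV.comp (f := fun p : (Dat × β × ℕ) × Dat => (p.1.1, p.1.2.1, p.2)) (by fun_prop)
  refine mem_NE_of_verifier (PT.id.et.pair (hr.pair (ET.mul_two_pow c))) hV' hsound fun x hx => ?_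
  obtain ⟨t, ht, hVt⟩ := hcomplete x hx
  refine ⟨t, (ht.trans (hc _)).trans ?_, hVt⟩
  simp only [sz_pair, sz_nat, sz_dat]
  omega

end

/-! ### All strings of a given length -/

/-- Prepends both bits to all strings. -/
def extend (X : List (List Bool)) : List (List Bool) :=
  X.map (List.cons true) ++ X.map (List.cons false)

/-- The list of all strings of length `n`. -/
def strings (n : ℕ) : List (List Bool) := extend^[n] [[]]

theorem strings_succ (n : ℕ) : strings (n + 1) = extend (strings n) :=
  Function.iterate_succ_apply' _ _ _

theorem mem_strings {n : ℕ} {x : List Bool} : x ∈ strings n ↔ x.length = n := by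
  induction n generalizing x with
  | zero => simp [strings]
  | succ n ih =>
    rw [strings_succ]
    cases x with
    | nil => simp [extend]
    | cons b x => cases b <;> simp [extend, ih]

theorem length_strings (n : ℕ) : (strings n).length = 2 ^ n := by
  induction n with
  | zero => rfl
  | succ n ih => simp [strings_succ, extend, ih, pow_succ, Nat.mul_two]

theorem sz_strings_le (n : ℕ) : sz (strings n) ≤ 2 ^ n * (2 * n + 1) := by
  rw [← length_strings]
  refine sz_le_length_mul _ _ fun x hx => (sz_bits_le x).trans ?_
  rw [mem_strings.mp hx]

theorem ET.strings {O : Language Bool} {α : Type} [Enc α] {e : α → Dat} (he : ET O e)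
    (hsize : ∀ a, (e a).size ≤ sz a) : ET O fun a => strings (e a).size := by
  refine iterateTree (step := extend) he (PT.const [[]]).et (by unfold extend; fun_prop)
    (ExpBound.two_pow_size.mul (((ExpBound.const 2).mul .size).add (.const 1))) fun a i hi => ?_
  have := hi.trans (hsize a)
  refine (sz_strings_le i).trans ?_
  gcongr
  norm_num

/-! ### Profiles of circuits -/

theorem eq_of_countP_le {α : Type*} {p q : α → Bool} {l : List α}
    (hpq : ∀ a ∈ l, p a = true → q a = true) (hqp : l.countP q ≤ l.countP p) :
    ∀ a ∈ l, p a = q a := by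
  induction l with
  | nil => simp
  | cons a l ih =>
    have hle : l.countP p ≤ l.countP q :=
      List.countP_mono_left fun x hx => hpq x (List.mem_cons_of_mem a hx)
    have ha := hpq a List.mem_cons_self
    simp only [List.countP_cons] at hqp
    have hpqa : p a = q a := by
      cases hp : p a <;> cases hq : q a <;> simp_all
      omega
    have hl := ih (fun x hx => hpq x (List.mem_cons_of_mem a hx)) (by rw [hpqa] at hqp; omega)
    exact fun x hx => (List.mem_cons.mp hx).elim (fun h => h ▸ hpqa) (hl x)

/-- The string whose lexicographic order is optimized by the search for a circuit: the number `c`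
of accepted inputs of length `n`, then the depth in unary as a number of zeros (so that smaller
depths are larger), then the description, padded to length `L`. The ones before and after the
description make it possible to find it. -/
def profile (L n c : ℕ) (G : List Gate) : List Bool :=
  (bits (n + 1) c ++ (List.replicate (maxDepth G) false ++
    true :: (G.flatMap Gate.encode ++ [true]))).rightpad L false

theorem profile_eq (L n c : ℕ) (G : List Gate) : ∃ r, profile L n c G =
    bits (n + 1) c ++ (List.replicate (maxDepth G) false ++
      true :: (G.flatMap Gate.encode ++ true :: List.replicate r false)) :=
  ⟨_, by simp [profile, List.rightpad]; rfl⟩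

/-- Removes the leading zeros and the first one. -/
def dropMarker (s : List Bool) : List Bool := (s.dropWhile not).tail

theorem dropMarker_replicate_append (d : ℕ) (s : List Bool) :
    dropMarker (List.replicate d false ++ true :: s) = s := by
  rw [dropMarker, List.dropWhile_append_of_pos (by simp)]
  rfl

/-- The description that occurs in a profile. -/
def description (n : ℕ) (s : List Bool) : List Bool :=
  (dropMarker (dropMarker (s.drop (n + 1))).reverse).reverse

theorem description_profile (L n c : ℕ) (G : List Gate) :
    description n (profile L n c G) = G.flatMap Gate.encode := by
  obtain ⟨r, hr⟩ := profile_eq L n c G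
  rw [description, hr, List.drop_left' (length_bits _ _), dropMarker_replicate_append,
    List.reverse_append, List.reverse_cons, List.reverse_replicate, List.append_assoc,
    List.singleton_append, dropMarker_replicate_append, List.reverse_reverse]

theorem length_encode_lt_length_profile (L n c : ℕ) (G : List Gate) :
    (G.flatMap Gate.encode).length < (profile L n c G).length := by
  obtain ⟨r, hr⟩ := profile_eq L n c G
  rw [hr]
  simp only [List.length_append, List.length_cons]
  omega

theorem length_profile {L n c : ℕ} {G : List Gate}
    (h : n + maxDepth G + (G.flatMap Gate.encode).length + 3 ≤ L) :
    (profile L n c G).length = L := by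
  rw [profile, List.length_rightpad, max_eq_left]
  simp only [List.length_append, length_bits, List.length_replicate, List.length_cons,
    List.length_nil]
  omega

theorem of_profile_le_profile {L n c c' : ℕ} {G G' : List Gate} (hc : c ≤ 2 ^ n) (hc' : c' ≤ 2 ^ n)
    (h : profile L n c G ≤ profile L n c' G') :
    c ≤ c' ∧ (c = c' → maxDepth G' ≤ maxDepth G) := by
  have hpow : 2 ^ n < 2 ^ (n + 1) := Nat.pow_lt_pow_right one_lt_two n.lt_succ_self
  obtain ⟨r, hr⟩ := profile_eq L n c G
  obtain ⟨r', hr'⟩ := profile_eq L n c' G'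
  rw [hr, hr', append_le_append_iff_of_length_eq (by simp only [length_bits])] at h
  refine ⟨(bits_le_bits_iff (hc.trans_lt hpow) (hc'.trans_lt hpow)).mp ?_, ?_⟩
  · exact h.elim le_of_lt fun h => h.1.le
  · rintro rfl
    exact le_of_replicate_le_replicate (h.resolve_left (lt_irrefl _)).2

namespace Circuit

variable {m n : ℕ} {A : Language Bool}

/-- All strings accepted by the circuit belong to the language. -/
def Sound (m : ℕ) (A : Language Bool) (C : Circuit n) : Prop :=
  ∀ x : List Bool, x.length = n → C.eval m x = true → x ∈ A

/-- The circuit decides the language for strings of its input length. -/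
def Correct (m : ℕ) (A : Language Bool) (C : Circuit n) : Prop :=
  ∀ x : List Bool, x.length = n → (x ∈ A ↔ C.eval m x = true)

/-- The number of strings accepted by a circuit. -/
def acceptCount (m : ℕ) (C : Circuit n) : ℕ := (strings n).countP (C.eval m)

theorem acceptCount_le (C : Circuit n) : C.acceptCount m ≤ 2 ^ n :=
  (List.countP_le_length).trans_eq (length_strings n)

/-- The profile of a circuit, padded to length `L`. -/
def profile (m L : ℕ) (C : Circuit n) : List Bool :=
  ACCUniform.profile L n (C.acceptCount m) C.gates

theorem optimal_of_profile_le {L : ℕ} {C D : Circuit n} (hC : C.Sound m A) (hD : D.Correct m A)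
    (h : D.profile m L ≤ C.profile m L) : C.Correct m A ∧ C.depth ≤ D.depth := by
  obtain ⟨hcount, hdepth⟩ := of_profile_le_profile D.acceptCount_le C.acceptCount_le h
  have heval := eq_of_countP_le (p := C.eval m) (q := D.eval m)
    (fun x hx hCx => (hD x (mem_strings.mp hx)).mp (hC x (mem_strings.mp hx) hCx)) hcount
  refine ⟨fun x hx => ?_, hdepth (hcount.antisymm ?_)⟩
  · rw [hD x hx, heval x (mem_strings.mpr hx)]
  · exact (List.countP_congr fun x hx => by rw [heval x hx]).le

end Circuit

/-- The profiles of length `L` of sound circuits. -/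
def profiles (A : Language Bool) (m n L : ℕ) : Set (List Bool) :=
  {s | s.length = L ∧ ∃ C : Circuit n, C.Sound m A ∧ C.profile m L = s}

/-! ### The search oracle -/

theorem Machine.HaltsWithin.exists_accepting_of_accepts {M : Machine} {O : Language Bool}
    {x : List Bool} {T : ℕ} (hT : M.HaltsWithin O x T) (h : M.Accepts O x) :
    ∃ g : List Bool, g.length ≤ T ∧ (M.run O g (M.init x)).Accepting := by
  obtain ⟨g, hg⟩ := h
  rcases le_total g.length T with hl | hl
  · exact ⟨g, hl, hg⟩
  · refine ⟨g.take T, by simp, ?_⟩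
    have hhalt := hT (g.take T) (by simpa using hl)
    rwa [← List.take_append_drop T g, run_append, hhalt.run_eq] at hg

open Classical in
/-- Whether `G` is a circuit whose profile has length `L` and begins with the reverse of `w`, and
for every accepted string from `X` the list `W` contains an accepting choice sequence of `M`. -/
noncomputable def check (M : Machine) (m n L : ℕ) (w : List Bool) (X : List (List Bool))
    (G : List Gate) (W : List (List Bool)) : Bool :=
  decide (IsCircuit n G) &&
  (X.all fun x => !gateOutput m G x || W.any fun g => decide (M.run ⊥ g (M.init x)).Accepting) &&
  decide ((profile L n (X.countP fun x => gateOutput m G x) G).length = L) &&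
  w.reverse.isPrefixOf (profile L n (X.countP fun x => gateOutput m G x) G)

theorem check_strings_iff {M : Machine} {m n L : ℕ} {w : List Bool} {G : List Gate}
    {W : List (List Bool)} : check M m n L w (strings n) G W = true ↔
      ∃ C : Circuit n, C.gates = G ∧
        (∀ x : List Bool, x.length = n → C.eval m x = true →
          ∃ g ∈ W, (M.run ⊥ g (M.init x)).Accepting) ∧
        (C.profile m L).length = L ∧ w.reverse <+: C.profile m L := by
  simp only [check, Bool.and_eq_true, decide_eq_true_eq, List.all_eq_true, mem_strings,
    Bool.or_eq_true, Bool.not_eq_true', List.any_eq_true, List.isPrefixOf_iff_prefix,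
    ← Bool.not_eq_true, ← imp_iff_not_or]
  constructor
  · rintro ⟨⟨⟨hG, hW⟩, hL⟩, hw⟩
    exact ⟨⟨G, hG.1, hG.2⟩, rfl, hW, hL, hw⟩
  · rintro ⟨C, rfl, hW, hL, hw⟩
    exact ⟨⟨⟨⟨C.nonempty, C.wellFormed⟩, hW⟩, hL⟩, hw⟩

namespace PT

variable {O : Language Bool} {α : Type} [Enc α]

@[fun_prop]
theorem profile {L n c : α → ℕ} {G : α → List Gate} (hL : PT O L) (hn : PT O n) (hc : PT O c)
    (hG : PT O G) : PT O fun a => profile (L a) (n a) (c a) (G a) := by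
  unfold ACCUniform.profile List.rightpad
  fun_prop

theorem check {M : Machine} (hM : M.QueryFree) {m : ℕ} {n L : α → ℕ} {w : α → List Bool}
    {X W : α → List (List Bool)} {G : α → List Gate} (hn : PT O n) (hL : PT O L) (hw : PT O w)
    (hX : PT O X) (hG : PT O G) (hW : PT O W) :
    PT O fun a => check M m (n a) (L a) (w a) (X a) (G a) (W a) := by
  have haccepting := PT.accepting (O := O) hM (α := (α × List Bool) × List Bool)
    (x := fun p => p.1.2) (g := fun p => p.2) (by fun_prop) (by fun_prop)
  unfold ACCUniform.check
  fun_prop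

@[fun_prop]
theorem description {n : α → ℕ} {s : α → List Bool} (hn : PT O n) (hs : PT O s) :
    PT O fun a => description (n a) (s a) := by
  have hdrop {s : α → List Bool} (hs : PT O s) : PT O fun a => dropMarker (s a) :=
    (hs.dropWhile PT.id.not).tail
  unfold ACCUniform.description
  fun_prop

end PT

theorem sz_lt_length_encodeArgs (js : List ℕ) : sz js < (encodeArgs js).length := by
  induction js with
  | nil => simp [encodeArgs]
  | cons j js ih =>
    simp only [encodeArgs, encodeNat, List.flatMap_cons, List.length_append, List.length_cons,
      List.length_replicate, List.length_nil, sz_cons, sz_nat] at *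
    omega

theorem Gate.sz_lt (g : Gate) : sz g < 2 * g.encode.length := by
  have hsz : sz g = g.tag + sz g.nums + 1 := by
    rw [← sz_nat g.tag]
    rfl
  rw [hsz]
  cases g with
  | input i | not i => simp [tag, nums, args, encode, encodeNat]; omega
  | and js | or js | mod js =>
    have := sz_lt_length_encodeArgs js
    simp [tag, nums, args, encode]; omega

theorem sz_gates_le (G : List Gate) : sz G ≤ 2 * (G.flatMap Gate.encode).length := by
  induction G with
  | nil => simp
  | cons g G ih =>
    have := g.sz_lt
    simp only [List.flatMap_cons, List.length_append, sz_cons]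
    omega

/-- The language of the codes of triples `(n, L, w)` such that the reverse of `w` can be extended to
the profile of length `L` of a circuit that is sound for `A`. -/
def searchOracle (A : Language Bool) (m : ℕ) : Language Bool :=
  {x | ∃ s ∈ profiles A m (Dat.ofCode x).hd.size (Dat.ofCode x).tl.hd.size,
    (Dat.ofCode x).tl.tl.toBits.reverse <+: s}

theorem code_mem_searchOracle_iff {A : Language Bool} {m n L : ℕ} {w : List Bool} :
    (enc (n, L, w)).code ∈ searchOracle A m ↔ ∃ s ∈ profiles A m n L, w.reverse <+: s := by
  have hz : Dat.ofCode (enc (n, L, w)).code = .cons (enc n) (.cons (enc L) (enc w)) :=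
    Dat.ofCode_code _
  change (∃ s ∈ profiles A m _ _, _) ↔ _
  simp only [hz, Dat.hd, Dat.tl, Dat.size_enc, Dat.toBits_enc]

section

variable {M : Machine} {A : Language Bool} {m n L : ℕ} {w : List Bool}

theorem exists_mem_profiles_of_check {G : List Gate} {W : List (List Bool)}
    (hA : ∀ x, M.Accepts ⊥ x → x ∈ A) (h : check M m n L w (strings n) G W = true) :
    ∃ s ∈ profiles A m n L, w.reverse <+: s := by
  obtain ⟨C, -, hC, hL, hw⟩ := check_strings_iff.mp h
  refine ⟨_, ⟨hL, C, fun x hx hCx => ?_, rfl⟩, hw⟩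
  obtain ⟨g, -, hg⟩ := hC x hx hCx
  exact hA x ⟨g, hg⟩

theorem exists_check_of_mem_profiles {T : ℕ} {s : List Bool}
    (hA : ∀ x ∈ A, x.length = n → ∃ g : List Bool, g.length ≤ T ∧
      (M.run ⊥ g (M.init x)).Accepting)
    (hs : s ∈ profiles A m n L) (hw : w.reverse <+: s) :
    ∃ t : Dat, t.size ≤ 2 * L + 2 ^ n * (2 * T + 1) + 1 ∧ check M m n L w (strings n)
      (t.hd.toList.map Dat.toGate) (t.tl.toList.map Dat.toBits) = true := by
  obtain ⟨hL, C, hC, rfl⟩ := hs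
  have hchoice : ∀ x : List Bool, ∃ g : List Bool, g.length ≤ T ∧
      (x.length = n → x ∈ A → (M.run ⊥ g (M.init x)).Accepting) := fun x => by
    by_cases hx : x ∈ A ∧ x.length = n
    · exact (hA x hx.1 hx.2).imp fun g hg => ⟨hg.1, fun _ _ => hg.2⟩
    · exact ⟨[], T.zero_le, fun h h' => absurd ⟨h', h⟩ hx⟩
  choose f hfT hf using hchoice
  refine ⟨.cons (enc C.gates) (enc ((strings n).map f)), ?_, ?_⟩
  · have hG : sz C.gates ≤ 2 * L := (sz_gates_le C.gates).trans
      (Nat.mul_le_mul_left 2 (hL ▸ (length_encode_lt_length_profile ..).le))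
    have hW : sz ((strings n).map f) ≤ 2 ^ n * (2 * T + 1) := by
      rw [← length_strings n, ← List.length_map f]
      refine sz_le_length_mul _ _ fun g hg => (sz_bits_le g).trans ?_
      obtain ⟨x, -, rfl⟩ := List.mem_map.mp hg
      exact Nat.mul_le_mul_left 2 (hfT x)
    exact Nat.succ_le_succ (Nat.add_le_add hG hW)
  · simp only [Dat.hd, Dat.tl, Dat.toList_enc, List.map_map, Function.comp_def, Dat.toGate_enc,
      Dat.toBits_enc, List.map_id']
    refine check_strings_iff.mpr ⟨C, rfl, fun x hx hCx => ?_, hL, hw⟩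
    exact ⟨f x, List.mem_map_of_mem (mem_strings.mpr hx), hf x hx (hC x hx hCx)⟩

end

theorem searchOracle_mem_NE {A : Language Bool} (hA : A ∈ NE) (m : ℕ) : searchOracle A m ∈ NE := by
  obtain ⟨M, hM, c, hc⟩ := hA
  refine mem_NE_of_certificates (r := fun z => strings z.hd.size)
    (V := fun p => check M m p.1.hd.size p.1.tl.hd.size p.1.tl.tl.toBits p.2.1
      (p.2.2.hd.toList.map Dat.toGate) (p.2.2.tl.toList.map Dat.toBits))
    (u := fun z => 2 * z.size + 2 ^ z.size * (2 * (c * 2 ^ (c * z.size)) + 1) + 1)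
    (ET.strings (PT.hd PT.id).et Dat.size_hd_le)
    (PT.check hM (by fun_prop) (by fun_prop) (by fun_prop) (by fun_prop) (by fun_prop)
      (by fun_prop)) ?_ (fun x t ht => ?_) fun x hx => ?_
  · exact (((ExpBound.const 2).mul .size).add (.mul .two_pow_size
      (((ExpBound.const 2).mul ⟨c, fun z => le_rfl⟩).add (.const 1)))).add (.const 1)
  · exact exists_mem_profiles_of_check (fun x => (hc x).2.mpr) ht
  · obtain ⟨s, hs, hw⟩ := hx
    obtain ⟨t, ht, htV⟩ := exists_check_of_mem_profiles (T := c * 2 ^ (c * (Dat.ofCode x).hd.size))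
      (fun y hy hyn => hyn ▸ (hc y).1.exists_accepting_of_accepts ((hc y).2.mp hy)) hs hw
    refine ⟨t, ht.trans ?_, htV⟩
    have hn : (Dat.ofCode x).hd.size ≤ (Dat.ofCode x).size := Dat.size_hd_le _
    have hL : (Dat.ofCode x).tl.hd.size ≤ (Dat.ofCode x).size :=
      (Dat.size_hd_le _).trans (Dat.size_tl_le _)
    gcongr <;> norm_num

/-! ### Lengths of descriptions -/

theorem length_encodeArgs (js : List ℕ) : (encodeArgs js).length = js.sum + 2 * js.length + 1 := by
  induction js with
  | nil => rfl
  | cons j js ih =>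
    simp only [encodeArgs, encodeNat, List.flatMap_cons, List.length_append, List.length_cons,
      List.length_replicate, List.length_nil, List.sum_cons] at *
    omega

theorem Gate.one_add_length_args_le_length_encode (g : Gate) :
    1 + g.args.length ≤ g.encode.length := by
  cases g <;> simp [args, encode, encodeNat, length_encodeArgs] <;> omega

theorem Gate.WellFormed.length_encode_le {n pos B : ℕ} {g : Gate} (hg : g.WellFormed n pos)
    (hn : n ≤ B) (hpos : pos ≤ B) : g.encode.length ≤ (1 + g.args.length) * (B + 4) := by
  have hargs {js : List ℕ} (hjs : ∀ j ∈ js, j < pos) :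
      3 + (encodeArgs js).length ≤ (1 + js.length) * (B + 4) := by
    have hsum : js.sum ≤ js.length * B := by
      rw [← smul_eq_mul]
      exact List.sum_le_card_nsmul js B fun j hj => (hjs j hj).le.trans hpos
    rw [length_encodeArgs]
    linarith
  cases g with
  | input i =>
    have hi : i < n := hg
    simp only [args, encode, encodeNat, List.length_cons, List.length_append,
      List.length_replicate, List.length_nil]
    omega
  | not j =>
    have hj : j < pos := hg j (List.mem_singleton_self j)
    simp only [args, encode, encodeNat, List.length_cons, List.length_append,
      List.length_replicate, List.length_nil]
    omega
  | and js | or js | mod js =>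
    have : 3 + (encodeArgs js).length ≤ _ := hargs hg
    simp only [args, encode, List.length_cons]
    omega

namespace Circuit

variable {n : ℕ} (C : Circuit n)

theorem size_le_length_encode : C.size ≤ C.encode.length := by
  rw [size, encode, List.length_flatMap]
  exact List.sum_le_sum fun g _ => g.one_add_length_args_le_length_encode

theorem length_gates_le_size : C.gates.length ≤ C.size := by
  simp [size, List.sum_map_add]

theorem depth_le_size : C.depth ≤ C.size :=
  (maxDepth_le_length C.gates).trans C.length_gates_le_size

theorem length_encode_le : C.encode.length ≤ C.size * (C.size + n + 4) := by
  have h : ∀ g ∈ C.gates, g.encode.length ≤ (1 + g.args.length) * (C.size + n + 4) := by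
    intro g hg
    obtain ⟨i, hi, rfl⟩ := List.getElem_of_mem hg
    exact (C.wellFormed i hi).length_encode_le (Nat.le_add_left _ _)
      (hi.le.trans (C.length_gates_le_size.trans (Nat.le_add_right _ _)))
  rw [encode, List.length_flatMap, size, ← List.sum_map_mul_right]
  exact List.sum_le_sum h

end Circuit

theorem polyBound_eval (p : Polynomial ℕ) : PolyBound fun n : ℕ => p.eval n := by
  induction p using Polynomial.induction_on' with
  | add p q hp hq => simpa using hp.add hq
  | monomial k a => simpa using (PolyBound.const (α := ℕ) a).mul (PolyBound.size.pow k)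

theorem exists_length_profile_eq {C : (n : ℕ) → Circuit n} {p : Polynomial ℕ}
    (hp : ∀ n, (C n).size ≤ p.eval n) (m : ℕ) :
    ∃ K : ℕ, ∀ n, ((C n).profile m ((n + 2) ^ K)).length = (n + 2) ^ K := by
  have hn : PolyBound fun n : ℕ => n := by simpa using PolyBound.size (α := ℕ)
  have hp' := polyBound_eval p
  obtain ⟨K, hK⟩ :=
    ((hn.add hp').add (hp'.mul ((hp'.add hn).add (.const 4)))).add (.const 3)
  simp only [sz_nat] at hK
  refine ⟨K, fun n => length_profile ((hK n).trans' ?_)⟩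
  have hdepth := (C n).depth_le_size.trans (hp n)
  have hencode : (C n).encode.length ≤ p.eval n * (p.eval n + n + 4) := by
    refine (C n).length_encode_le.trans ?_
    gcongr <;> exact hp n
  exact Nat.add_le_add_right (Nat.add_le_add (Nat.add_le_add_left hdepth n) hencode) 3

/-! ### The search -/

open Classical in
/-- The lexicographically greatest string of length `(n + 2) ^ K` whose prefixes are all accepted by
the oracle. -/
noncomputable def searchResult (O : Language Bool) (K n : ℕ) : List Bool :=
  (greedy (fun w => decide ((enc (n, (n + 2) ^ K, w)).code ∈ O)) ((n + 2) ^ K)).reverse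

theorem PT.searchResult (O : Language Bool) (K : ℕ) : PT O fun n => searchResult O K n := by
  unfold ACCUniform.searchResult
  refine (greedy (PT.query (f := fun p : ℕ × List Bool => (p.1, (p.1 + 2) ^ K, p.2)) ?_) ?_).reverse
  all_goals fun_prop

open Classical in
theorem isGreatest_searchResult {A : Language Bool} {m K n : ℕ}
    (h : (profiles A m n ((n + 2) ^ K)).Nonempty) :
    IsGreatest (profiles A m n ((n + 2) ^ K)) (searchResult (searchOracle A m) K n) :=
  isGreatest_greedy (fun _ => decide_eq_true_iff.trans code_mem_searchOracle_iff) h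
    fun _ hs => hs.1

theorem exists_optimal_family {A : Language Bool} {m K : ℕ} {C : (n : ℕ) → Circuit n}
    (hC : ∀ n, (C n).Correct m A)
    (hK : ∀ n, ((C n).profile m ((n + 2) ^ K)).length = (n + 2) ^ K) :
    ∃ D : (n : ℕ) → Circuit n, ∀ n, (D n).Correct m A ∧ (D n).depth ≤ (C n).depth ∧
      (D n).size ≤ (n + 2) ^ K ∧
      description n (searchResult (searchOracle A m) K n) = (D n).encode := by
  have hmem (n : ℕ) : (C n).profile m ((n + 2) ^ K) ∈ profiles A m n ((n + 2) ^ K) :=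
    ⟨hK n, C n, fun x hx => (hC n x hx).mpr, rfl⟩
  have hgreatest (n : ℕ) := isGreatest_searchResult ⟨_, hmem n⟩
  choose hlen D hsound hprofile using fun n => (hgreatest n).1
  refine ⟨D, fun n => ?_⟩
  have hle : (C n).profile m _ ≤ (D n).profile m _ := hprofile n ▸ (hgreatest n).2 (hmem n)
  obtain ⟨hcorrect, hdepth⟩ := Circuit.optimal_of_profile_le (hsound n) (hC n) hle
  refine ⟨hcorrect, hdepth, ?_, ?_⟩
  · rw [← hlen n, ← hprofile n]
    exact (D n).size_le_length_encode.trans (length_encode_lt_length_profile ..).le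
  · rw [← hprofile n]
    exact description_profile ..

theorem HasUniformACC.hasACC {k : ℕ} {A : Language Bool} (h : HasUniformACC k A) : HasACC k A :=
  let ⟨m, hm, C, hC, hA, _⟩ := h
  ⟨m, hm, C, hC, hA⟩

theorem HasACC.hasUniformACC {k : ℕ} {A : Language Bool} (hA : A ∈ NE) (h : HasACC k A) :
    HasUniformACC k A := by
  obtain ⟨m, hm, C, ⟨⟨p, hp⟩, d, hd⟩, hC⟩ := h
  obtain ⟨K, hK⟩ := exists_length_profile_eq hp m
  choose D hcorrect hdepth hsize hdescription using exists_optimal_family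
    (fun n x hx => hx ▸ hC x : ∀ n, (C n).Correct m A) hK
  refine ⟨m, hm, D, ⟨⟨(.X + 2) ^ K, fun n => by simpa using hsize n⟩, d, fun n =>
    (hdepth n).trans (hd n)⟩, fun x => hcorrect _ x rfl, _, ⟨searchOracle A m,
    searchOracle_mem_NE hA m, PT.mem_FPWith (.description .id (.searchResult _ K))⟩, fun j => ?_⟩
  rw [List.length_replicate, hdescription]

end ACCUniform

theorem theorem1_general (k : ℕ) {A : Language Bool} (hA : A ∈ ACCUniform.NE) :
    ACCUniform.HasACC k A ↔ ACCUniform.HasUniformACC k A :=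
  ⟨fun h => h.hasUniformACC hA, fun h => h.hasACC⟩

theorem theorem1 (k : ℕ) :
    (∀ A ∈ ACCUniform.NE, ACCUniform.HasACC k A) ↔
      (∀ A ∈ ACCUniform.NE, ACCUniform.HasUniformACC k A) :=
  forall₂_congr fun _ hA => theorem1_general k hA
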